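/- Let $\alpha>-1$ and let $n\ge 1$ be an integer. Put $\omega(x)=(1-x^2)^\alpha$ on $(-1,1)$, let $J_n=J_n^{\alpha,\alpha}$ be the Jacobi polynomial of degree $n$ with both parameters equal to $\alpha$, in Szegő's normalization (so that $(1-x^2)^\alpha J_n(x)=\frac{(-1)^n}{2^n n!}\frac{d^n}{dx^n}(1-x^2)^{\alpha+n}$), and let $$\gamma_n=\frac{2^{2\alpha+1}\Gamma(n+\alpha+1)^2}{(2n+2\alpha+1)\,n!\,\Gamma(n+2\alpha+1)}.$$ For $j\ge 0$ let $\sigma_{n,j}=\frac1{\gamma_n}\int_{-1}^1U_{n+j}(x)J_n(x)\omega(x)\,dx$, where $U_k$ is the Chebyshev polynomial of the second kind. If $\alpha\ne-\frac12$, let $$g_0=1,\qquad g_k=\frac{\Gamma(k+\alpha+\frac12)}{k!\,\Gamma(\alpha+\frac12)}\ (1\le k\le n),\qquad A_n=\frac{\Gamma(2\alpha+1)\Gamma(n+\alpha+1)}{\Gamma(\alpha+1)\Gamma(n+2\alpha+1)};$$ if $\alpha=-\frac12$, let $g_0=g_n=1$, $g_k=0$ for $1\le k\le n-1$, and $A_n=\frac{\Gamma(n+\frac12)}{2\sqrt\pi\,n!}$.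 Define $\mu_{n,2l}$, $l\ge0$, recursively by $$\mu_{n,0}=\frac{\sigma_{n,0}}{A_ng_n},\qquad \mu_{n,2l}=\frac1{g_n}\Big(\frac{\sigma_{n,2l}}{A_n}-\sum_{k=1}^{\min\{n,l\}}g_kg_{n-k}\,\mu_{n,2l-2k}\Big),\quad l\ge1.$$ Then: (a) The $\mu_{n,2l}$ are the Laurent coefficients of $Q_n/J_n$, where $Q_n(z)=\frac1{2\gamma_n}\int_{-1}^1\frac{J_n(x)\omega(x)}{z-x}\,dx$: for every $w\in\mathbb C$ with $|w|>1$ and $z=\frac12(w+w^{-1})$ we have $J_n(z)\ne0$ and $$\frac{Q_n(z)}{J_n(z)}=\sum_{l=0}^\infty\frac{\mu_{n,2l}}{w^{2n+2l+1}}.$$ (b) $\sup_{l\ge0}|\mu_{n,2l+2}-\mu_{n,2l}|<\infty$. (c) Let $\rho>1$, let $\mathcal E_\rho=\{\frac12(w+w^{-1}):|w|=\rho\}$, let $u$ be analytic on and within the ellipse $\mathcal E_\rho$ (that is, on a neighbourhood of the closed region that it bounds), and let $M=\max_{z\in\mathcal E_\rho}|u(z)|$. Let $x_1,\dots,x_n$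 be the zeros of $J_n$, let $\omega_1,\dots,\omega_n$ be the corresponding Gauss weights (the integrals against $\omega$ of the Lagrange basis polynomials of these nodes), and let $E_n^{GG}[u]=\int_{-1}^1u(x)\omega(x)\,dx-\sum_{j=1}^nu(x_j)\omega_j$ be the remainder of Gegenbauer–Gauss quadrature. Then $$\big|E_n^{GG}[u]\big|\le\gamma_n\Big[|\mu_{n,0}|+\sup_{l\ge0}\big|\mu_{n,2l+2}-\mu_{n,2l}\big|\,\frac1{\rho^2-1}\Big]\frac{M}{\rho^{2n}}.$$ -/

import Mathlib

noncomputable section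

namespace GegenbauerGauss

/-- The Jacobi weight `(1 - x)^α (1 + x)^β`. -/
def weight (α β x : ℝ) : ℝ := (1 - x) ^ α * (1 + x) ^ β

/-- The generalized binomial coefficient `r (r - 1) ⋯ (r - k + 1) / k!`. -/
def binom (r : ℝ) (k : ℕ) : ℝ := (descPochhammer ℝ k).eval r / (k.factorial : ℝ)

/-- The Jacobi polynomial of degree `n`, in Szegő's normalization:
`∑ s, binom(n + α, n - s) binom(n + β, s) ((X - 1) / 2)^s ((X + 1) / 2)^(n - s)`.
It is the polynomial given by Rodrigues' formula, see `rodrigues` below. -/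
def jacobi (n : ℕ) (α β : ℝ) : Polynomial ℝ :=
  ∑ s ∈ Finset.range (n + 1),
    Polynomial.C (binom (n + α) (n - s) * binom (n + β) s) *
      ((Polynomial.C (1 / 2) * (Polynomial.X - 1)) ^ s *
        (Polynomial.C (1 / 2) * (Polynomial.X + 1)) ^ (n - s))

/-- Rodrigues' formula for the Jacobi polynomials. -/
theorem rodrigues (n : ℕ) (α β x : ℝ) (hx : x ∈ Set.Ioo (-1 : ℝ) 1) :
    (1 - x) ^ α * (1 + x) ^ β * (jacobi n α β).eval x =
      (-1) ^ n / (2 ^ n * (n.factorial : ℝ)) *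
        iteratedDeriv n (fun t : ℝ => (1 - t) ^ (α + n) * (1 + t) ^ (β + n)) x := by
  obtain ⟨h1, h2⟩ := hx
  have p1 : 0 < 1 - x := by linarith
  have p2 : 0 < 1 + x := by linarith
  have d1 : ∀ (r : ℝ) (k : ℕ), iteratedDeriv k (fun t : ℝ => (1 - t) ^ r) x =
      (-1) ^ k * ((descPochhammer ℝ k).eval r * (1 - x) ^ (r - k)) := by
    intro r k
    have h := congrFun (iteratedDeriv_comp_neg k (fun t : ℝ => (1 + t) ^ r) |> funext) x
    have h' : iteratedDeriv k (fun t : ℝ => (1 + t) ^ r) (-x) =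
        (descPochhammer ℝ k).eval r * (1 - x) ^ (r - k) := by
      rw [iteratedDeriv_comp_const_add k (fun t : ℝ => t ^ r) 1, iteratedDeriv_eq_iterate]
      exact Real.iter_deriv_rpow_const r (1 + -x) k
    rw [h'] at h
    simpa [sub_eq_add_neg] using h
  have d2 : ∀ (r : ℝ) (k : ℕ), iteratedDeriv k (fun t : ℝ => (1 + t) ^ r) x =
      (descPochhammer ℝ k).eval r * (1 + x) ^ (r - k) := by
    intro r k
    rw [iteratedDeriv_comp_const_add k (fun t : ℝ => t ^ r) 1, iteratedDeriv_eq_iterate]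
    exact Real.iter_deriv_rpow_const r (1 + x) k
  have c1 : ContDiffAt ℝ n (fun t : ℝ => (1 - t) ^ (α + n)) x :=
    ContDiffAt.rpow_const_of_ne (by fun_prop) p1.ne'
  have c2 : ContDiffAt ℝ n (fun t : ℝ => (1 + t) ^ (β + n)) x :=
    ContDiffAt.rpow_const_of_ne (by fun_prop) p2.ne'
  rw [iteratedDeriv_fun_mul c1 c2, ← Finset.sum_range_reflect, Finset.mul_sum, jacobi,
    Polynomial.eval_finsetSum, Finset.mul_sum]
  refine Finset.sum_congr rfl fun s hs => ?_
  have hs' : s ≤ n := Nat.lt_succ_iff.mp (Finset.mem_range.mp hs)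
  obtain ⟨m, rfl⟩ := Nat.exists_eq_add_of_le hs'
  have e1 : s + m + 1 - 1 - s = m := by omega
  have e2 : s + m - m = s := by omega
  have e3 : s + m - s = m := by omega
  rw [e1, e2, e3, d1, d2]
  have q1 : (1 - x) ^ (α + ((s + m : ℕ) : ℝ) - m) = (1 - x) ^ α * (1 - x) ^ s := by
    rw [← Real.rpow_natCast, ← Real.rpow_add p1]; push_cast; ring_nf
  have q2 : (1 + x) ^ (β + ((s + m : ℕ) : ℝ) - s) = (1 + x) ^ β * (1 + x) ^ m := by
    rw [← Real.rpow_natCast, ← Real.rpow_add p2]; push_cast; ring_nf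
  have q3 : (((s + m).choose m : ℕ) : ℝ) =
      ((s + m).factorial : ℝ) / ((s.factorial : ℝ) * (m.factorial : ℝ)) := by
    rw [Nat.cast_choose ℝ (Nat.le_add_left m s), e2, mul_comm (m.factorial : ℝ)]
  have f0 : ((s + m).factorial : ℝ) ≠ 0 := by positivity
  have f1 : (s.factorial : ℝ) ≠ 0 := by positivity
  have f2 : (m.factorial : ℝ) ≠ 0 := by positivity
  have q4 : (x - 1) ^ s = (-1) ^ s * (1 - x) ^ s := by rw [← mul_pow]; ring_nf
  have q5 : ((-1 : ℝ) ^ m) * (-1) ^ m = 1 := by rw [← mul_pow]; simp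
  rw [q1, q2, q3]
  simp only [Polynomial.eval_mul, Polynomial.eval_pow, Polynomial.eval_sub, Polynomial.eval_add,
    Polynomial.eval_X, Polynomial.eval_C, Polynomial.eval_one, binom, mul_pow, q4, pow_add]
  rw [add_comm α, add_comm β]
  field_simp
  have q6 : ((1 / 2 : ℝ) ^ s) * 2 ^ s = 1 := by rw [← mul_pow]; norm_num
  have q7 : ((1 / 2 : ℝ) ^ m) * 2 ^ m = 1 := by rw [← mul_pow]; norm_num
  linear_combination
    Polynomial.eval (((s + m : ℕ) : ℝ) + α) (descPochhammer ℝ m) *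
      Polynomial.eval (((s + m : ℕ) : ℝ) + β) (descPochhammer ℝ s) * (1 + x) ^ m *
      (((1 / 2 : ℝ) ^ m) * 2 ^ m * q6 + q7 - q5)

/-- The squared norm `∫ (J_n^{α,β})² ω^{α,β}` in closed form. -/
def gam (n : ℕ) (α β : ℝ) : ℝ :=
  2 ^ (α + β + 1) * Real.Gamma (n + α + 1) * Real.Gamma (n + β + 1) /
    ((2 * n + α + β + 1) * (n.factorial : ℝ) * Real.Gamma (n + α + β + 1))

/-- `σ_{n,j}^{α,β} = (1 / γ_n) ∫_{-1}^1 U_{n+j} J_n ω`, with `U_k` the Chebyshev polynomial of the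
second kind. -/
def sigma (n j : ℕ) (α β : ℝ) : ℝ :=
  1 / gam n α β * ∫ x in (-1 : ℝ)..1,
    (Polynomial.Chebyshev.U ℝ ((n + j : ℕ) : ℤ)).eval x * (jacobi n α β).eval x * weight α β x

/-- The coefficients `g_k^α`, `0 ≤ k ≤ n`; for `α = -1/2` (the Chebyshev case) they depend on `n`. -/
def g (n : ℕ) (α : ℝ) (k : ℕ) : ℝ :=
  if α = -1 / 2 then (if k = 0 ∨ k = n then 1 else 0)
  else if k = 0 then 1
  else Real.Gamma (k + α + 1 / 2) / ((k.factorial : ℝ) * Real.Gamma (α + 1 / 2))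

/-- The coefficient `A_n^α`. -/
def A (n : ℕ) (α : ℝ) : ℝ :=
  if α = -1 / 2 then Real.Gamma (n + 1 / 2) / (2 * Real.sqrt Real.pi * (n.factorial : ℝ))
  else Real.Gamma (2 * α + 1) * Real.Gamma (n + α + 1) /
    (Real.Gamma (α + 1) * Real.Gamma (n + 2 * α + 1))

/-- `mu n α l` is `μ_{n,2l}^{α,α}`, defined by recursion on `l`; see `mu_zero` and `mu_recursion`
for the recursion in its usual form. -/
def mu (n : ℕ) (α : ℝ) (l : ℕ) : ℝ :=
  1 / g n α n * (sigma n (2 * l) α α / A n α -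
    ∑ k : Fin (min n l), g n α (k + 1) * g n α (n - (k + 1)) * mu n α (l - (k + 1)))
termination_by l
decreasing_by
  have := k.isLt
  omega

theorem mu_zero (n : ℕ) (α : ℝ) : mu n α 0 = sigma n 0 α α / (A n α * g n α n) := by
  have : IsEmpty (Fin (min n 0)) := by rw [Nat.min_zero]; infer_instance
  rw [mu, Finset.univ_eq_empty, Finset.sum_empty, sub_zero, Nat.mul_zero, one_div_mul_eq_div,
    div_div]

theorem mu_recursion (n : ℕ) (α : ℝ) (l : ℕ) :
    mu n α l = 1 / g n α n * (sigma n (2 * l) α α / A n α -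
      ∑ k ∈ Finset.Icc 1 (min n l), g n α k * g n α (n - k) * mu n α (l - k)) := by
  rw [mu, Finset.sum_fin_eq_sum_range]
  congr 2
  rw [← Finset.Ico_add_one_right_eq_Icc, Finset.sum_Ico_eq_sum_range]
  refine Finset.sum_congr (by simp) fun k hk => ?_
  rw [dif_pos (by simpa using hk), add_comm k 1]

/-- The map `w ↦ (w + w⁻¹) / 2`. -/
def joukowski (w : ℂ) : ℂ := (w + w⁻¹) / 2

/-- The Bernstein ellipse `ℰ_ρ`, the image of the circle `|w| = ρ`. -/
def ellipse (ρ : ℝ) : Set ℂ := joukowski '' {w : ℂ | ‖w‖ = ρ}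

/-- The closed region bounded by the Bernstein ellipse `ℰ_ρ`: the union of the segment `[-1, 1]`
(which is the image of `|w| = 1`) and of the ellipses `ℰ_r` with `1 < r ≤ ρ`. -/
def ellipseRegion (ρ : ℝ) : Set ℂ := joukowski '' {w : ℂ | 1 ≤ ‖w‖ ∧ ‖w‖ ≤ ρ}

/-- `u` is analytic on and within `ℰ_ρ`, that is, on a neighbourhood of the closed region. -/
def AnalyticOnWithin (ρ : ℝ) (u : ℂ → ℂ) : Prop := AnalyticOnNhd ℂ u (ellipseRegion ρ)

/-- `M = max_{z ∈ ℰ_ρ} |u(z)|`. -/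
def maxOnEllipse (ρ : ℝ) (u : ℂ → ℂ) : ℝ := sSup ((fun z => ‖u z‖) '' ellipse ρ)

/-- The Gegenbauer–Gauss nodes: the zeros of `J_n^{α,α}`. -/
def nodes (n : ℕ) (α : ℝ) : Finset ℝ := (jacobi n α α).roots.toFinset

/-- The Gauss quadrature weight at the node `y`: the integral of the Lagrange basis polynomial. -/
def gaussWeight (n : ℕ) (α y : ℝ) : ℝ :=
  ∫ x in (-1 : ℝ)..1, (Lagrange.basis (nodes n α) id y).eval x * weight α α x

/-- The Gegenbauer–Gauss quadrature remainder
`E_n^{GG}[u] = ∫_{-1}^1 u(x) (1 - x²)^α dx - ∑_j u(x_j) ω_j`. -/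
def remainder (n : ℕ) (α : ℝ) (u : ℂ → ℂ) : ℂ :=
  (∫ x in (-1 : ℝ)..1, u (x : ℂ) * (weight α α x : ℂ)) -
    ∑ y ∈ nodes n α, u (y : ℂ) * (gaussWeight n α y : ℂ)

/-- `Q_n^{α,α}(z) = (1 / (2 γ_n)) ∫_{-1}^1 J_n(x) ω(x) / (z - x) dx`. -/
def Q (n : ℕ) (α : ℝ) (z : ℂ) : ℂ :=
  1 / (2 * (gam n α α : ℂ)) * ∫ x in (-1 : ℝ)..1,
    (((jacobi n α α).eval x * weight α α x : ℝ) : ℂ) / (z - (x : ℂ))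

/-- `J_n^{α,α}(z)` at a complex point `z`. -/
def J (n : ℕ) (α : ℝ) (z : ℂ) : ℂ := Polynomial.aeval z (jacobi n α α)

end GegenbauerGauss

end

open Polynomial MeasureTheory

namespace GegenbauerGauss

/-! ### Orthogonality from the self-adjoint Gegenbauer operator. -/

section Moment

/-! Everything comes from evaluating the Gauss remainder functional E on Chebyshev polynomials:
E[U_{2n+2l}] = γ_n μ_{n,2l}, and E vanishes on every other U_k.

Two facts give this. First, J_n = A_n Σ_k g_k g_{n-k} T_{n-2k} (`jacobi_eq`). Both sides are
eigenpolynomials of the Gegenbauer operator with the same leading coefficient. Their difference has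
degree below n, hence is orthogonal to itself and vanishes. Second, J_n vanishes at the nodes, so
E[U_{n+j} J_n] = ∫ U_{n+j} J_n ω = γ_n σ_{n,j}. Expanding the product by 2 T_a U_m = U_{m+a} +
U_{m-a} turns this into a linear recursion for E[U_{2n+j-2k}] (`sum_quadError_U`). Gaussian
exactness below degree 2n and parity then reduce it to the recursion defining μ.

For (a), J_n(z)/(z-x) differs from J_n(x)/(z-x) by a polynomial in x of degree below n, so
E[1/(z-x)] = 2γ_n Q_n(z)/J_n(z) (`remainder_inv_sub`). The expansion 1/(z-x) = 2 Σ U_k(x) w^{-k-1}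
gives the Laurent series.

For (b), 2T_k = U_k - U_{k-2} shows that γ_n(μ_{n,2l+2} - μ_{n,2l}) = E[2T_{2n+2l+2}]. This is
bounded because |T_k| ≤ 1 on [-1,1].

For (c), u is expanded in 1, 2T_1, 2T_2, … with coefficients at most M/ρ^k (`hasSum_chebyshev`).
Only the degrees 2n+2l contribute, and summing the geometric series ρ^{-2n-2l-2} over l ≥ 0 gives
ρ^{-2n}/(ρ²-1). -/

lemma intervalIntegrable_weight {α : ℝ} (hα : -1 < α) :
    IntervalIntegrable (weight α α) volume (-1) 1 := by
  have h1 : IntervalIntegrable (weight α α) volume (-1) 0 := by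
    have h := (intervalIntegral.intervalIntegrable_rpow' (a := 0) (b := 1) hα).comp_add_left 1
    norm_num at h
    refine h.continuousOn_mul (f := fun x => (1 + x) ^ α) (g := fun x => (1 - x) ^ α) ?_
    refine ContinuousOn.rpow_const (by fun_prop) fun x hx => ?_
    rw [Set.uIcc_of_le (by norm_num)] at hx
    left; linarith [hx.2]
  have h2 : IntervalIntegrable (weight α α) volume 0 1 := by
    have h := (intervalIntegral.intervalIntegrable_rpow' (a := 0) (b := 1) hα).comp_sub_left 1
    norm_num at h
    refine h.symm.mul_continuousOn (f := fun x => (1 - x) ^ α) (g := fun x => (1 + x) ^ α) ?_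
    refine ContinuousOn.rpow_const (by fun_prop) fun x hx => ?_
    rw [Set.uIcc_of_le (by norm_num)] at hx
    left; linarith [hx.1]
  exact h1.trans h2

lemma weight_pos (α : ℝ) {x : ℝ} (hx : x ∈ Set.Ioo (-1 : ℝ) 1) : 0 < weight α α x :=
  mul_pos (Real.rpow_pos_of_pos (by linarith [hx.2]) _)
    (Real.rpow_pos_of_pos (by linarith [hx.1]) _)

lemma intervalIntegrable_mul_weight {α : ℝ} (hα : -1 < α) {f : ℝ → ℝ} (hf : Continuous f) :
    IntervalIntegrable (fun x => f x * weight α α x) volume (-1) 1 :=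
  (intervalIntegrable_weight hα).continuousOn_mul hf.continuousOn

/-- The moment functional `p ↦ ∫ p ω` of the Gegenbauer weight. -/
noncomputable def moment (α : ℝ) (hα : -1 < α) : ℝ[X] →ₗ[ℝ] ℝ where
  toFun p := ∫ x in (-1 : ℝ)..1, p.eval x * weight α α x
  map_add' p q := by
    rw [← intervalIntegral.integral_add (intervalIntegrable_mul_weight hα p.continuous)
      (intervalIntegrable_mul_weight hα q.continuous)]
    simp [add_mul]
  map_smul' c p := by
    simp [← intervalIntegral.integral_const_mul, mul_assoc]

variable {α : ℝ} (hα : -1 < α)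

lemma moment_apply (p : ℝ[X]) :
    moment α hα p = ∫ x in (-1 : ℝ)..1, p.eval x * weight α α x := rfl

lemma moment_pos {p : ℝ[X]} (hp : p ≠ 0) (h : ∀ x ∈ Set.Ioo (-1 : ℝ) 1, 0 ≤ p.eval x) :
    0 < moment α hα p := by
  rw [moment_apply, intervalIntegral.integral_pos_iff_support_of_nonneg_ae' _
    (intervalIntegrable_mul_weight hα p.continuous)]
  · refine ⟨by norm_num, ?_⟩
    have hsub : Set.Ioo (-1 : ℝ) 1 \ (p.roots.toFinset : Set ℝ) ⊆
        (Function.support fun x => p.eval x * weight α α x) ∩ Set.Ioc (-1) 1 := by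
      rintro x ⟨hx, hr⟩
      refine ⟨mul_ne_zero ?_ (weight_pos α hx).ne', hx.1, hx.2.le⟩
      simpa [hp] using hr
    refine lt_of_lt_of_le ?_ (measure_mono hsub)
    rw [measure_sdiff_null (Finset.measure_zero _ _)]
    simp
  · rw [Set.uIoc_of_le (by norm_num)]
    have h1 : ∀ᵐ x : ℝ, x ≠ 1 := by simp [ae_iff]
    filter_upwards [ae_restrict_mem measurableSet_Ioc, ae_restrict_of_ae h1] with x hx hx1
    have hx' : x ∈ Set.Ioo (-1 : ℝ) 1 := ⟨hx.1, lt_of_le_of_ne hx.2 hx1⟩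
    exact mul_nonneg (h x hx') (weight_pos α hx').le

/-- The integrand is the derivative of (1-x²)^{α+1} q(x), which vanishes at ±1 because α+1 > 0. This
is the only integration by parts. -/
lemma moment_derivative_eq_zero (q : ℝ[X]) :
    moment α hα ((1 - X ^ 2) * derivative q - C (2 * α + 2) * X * q) = 0 := by
  have key := intervalIntegral.integral_eq_sub_of_hasDerivAt_of_le (a := (-1 : ℝ)) (b := 1)
    (by norm_num) (f := fun x => (1 - x) ^ (α + 1) * (1 + x) ^ (α + 1) * q.eval x)
    (f' := fun x => ((1 - X ^ 2) * derivative q - C (2 * α + 2) * X * q).eval x * weight α α x)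
    ?_ ?_ (intervalIntegrable_mul_weight hα
      (f := fun x => ((1 - X ^ 2) * derivative q - C (2 * α + 2) * X * q).eval x)
      (Polynomial.continuous _))
  · rw [moment_apply, key]
    have h0 : α + 1 ≠ 0 := by linarith
    norm_num [Real.zero_rpow h0]
  · have h0 : 0 ≤ α + 1 := by linarith
    refine Continuous.continuousOn ?_
    refine ((Continuous.rpow_const (by fun_prop) fun x => Or.inr h0).mul
      (Continuous.rpow_const (by fun_prop) fun x => Or.inr h0)).mul q.continuous
  · rintro x ⟨hx1, hx2⟩
    have p1 : 0 < 1 - x := by linarith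
    have p2 : 0 < 1 + x := by linarith
    have d1 := ((hasDerivAt_id x).const_sub 1).rpow_const (p := α + 1) (Or.inl p1.ne')
    have d2 := ((hasDerivAt_id x).const_add 1).rpow_const (p := α + 1) (Or.inl p2.ne')
    refine ((d1.mul d2).mul (q.hasDerivAt x)).congr_deriv ?_
    simp only [id, weight, add_sub_cancel_right, Real.rpow_add_one p1.ne',
      Real.rpow_add_one p2.ne', eval_sub, eval_mul, eval_one, eval_pow, eval_X, eval_C, Pi.mul_apply]
    ring

/-- The Gegenbauer differential operator `p ↦ (1 - x²) p'' - (2 α + 2) x p'`. -/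
noncomputable def diffOp (α : ℝ) (p : ℝ[X]) : ℝ[X] :=
  (1 - X ^ 2) * derivative (derivative p) - C (2 * α + 2) * X * derivative p

lemma moment_mul_diffOp (p q : ℝ[X]) :
    moment α hα (p * diffOp α q) = -moment α hα ((1 - X ^ 2) * derivative p * derivative q) := by
  have h := moment_derivative_eq_zero hα (p * derivative q)
  rw [← sub_eq_zero, sub_neg_eq_add, ← map_add, ← h]
  congr 1
  simp only [diffOp, derivative_mul]
  ring

lemma moment_diffOp_comm (p q : ℝ[X]) :
    moment α hα (p * diffOp α q) = moment α hα (q * diffOp α p) := by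
  rw [moment_mul_diffOp, moment_mul_diffOp]
  congr 2; ring

/-- The operator is self-adjoint and maps x^m to m(m-1)x^{m-2} - m(m+2α+1)x^m. Moving it from P to
x^m relates the m-th moment to the (m-2)-nd, with the difference of eigenvalues as a factor. -/
lemma moment_X_pow_mul_eq_zero {n : ℕ} {P : ℝ[X]}
    (hP : diffOp α P = C (-(n * (n + 2 * α + 1) : ℝ)) * P) (m : ℕ) (hm : m < n) :
    moment α hα (X ^ m * P) = 0 := by
  induction m using Nat.strong_induction_on with
  | _ m ih =>
    have h := moment_diffOp_comm hα (X ^ m) P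
    have e1 : X ^ m * diffOp α P = (-(n * (n + 2 * α + 1) : ℝ)) • (X ^ m * P) := by
      rw [hP, smul_eq_C_mul]; ring
    have e2 : P * diffOp α (X ^ m) = ((m : ℝ) * (m - 1 : ℕ)) • (X ^ (m - 2) * P) -
        (m * (m + 2 * α + 1) : ℝ) • (X ^ m * P) := by
      simp only [diffOp, derivative_X_pow, derivative_mul, smul_eq_C_mul,
        map_mul, map_add, map_natCast, map_ofNat, map_one]
      rcases m with _ | _ | m
      · simp
      · simp; ring
      · simp only [Nat.add_sub_cancel, show m + 1 + 1 - 2 = m by omega,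
          show m + 1 + 1 - 1 = m + 1 by omega, derivative_natCast]
        push_cast
        ring
    rw [e1, e2, map_sub, map_smul, map_smul, map_smul] at h
    -- For m < 2 the coefficient m(m-1) is zero, so the truncated exponent m-2 does no harm.
    have h2 : ((m : ℝ) * (m - 1 : ℕ)) • moment α hα (X ^ (m - 2) * P) = 0 := by
      rcases Nat.lt_or_ge m 2 with h | h
      · interval_cases m <;> simp
      · rw [ih (m - 2) (by omega) (by omega), smul_zero]
    rw [h2] at h
    simp only [smul_eq_mul] at h
    -- The eigenvalue difference factors; both factors are positive since n ≥ m+1 and 2α+2 > 0.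
    have hf : ((n : ℝ) - m) * (n + m + 2 * α + 1) * moment α hα (X ^ m * P) = 0 := by
      linear_combination -h
    have c1 : (m : ℝ) + 1 ≤ n := by exact_mod_cast hm
    have c2 : (0 : ℝ) ≤ m := Nat.cast_nonneg m
    rcases mul_eq_zero.mp hf with h' | h'
    · rcases mul_eq_zero.mp h' with h'' | h'' <;> linarith
    · exact h'

lemma moment_mul_eq_zero {n : ℕ} {P : ℝ[X]}
    (hP : diffOp α P = C (-(n * (n + 2 * α + 1) : ℝ)) * P) {q : ℝ[X]} (hq : q.degree < n) :
    moment α hα (q * P) = 0 := by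
  rcases n.eq_zero_or_pos with rfl | hn
  · have : q = 0 := by simpa using hq
    simp [this]
  have hd : q.natDegree < n := by
    rcases eq_or_ne q 0 with rfl | h0
    · simpa using hn
    · exact (natDegree_lt_iff_degree_lt h0).mpr hq
  conv_lhs => rw [q.as_sum_range' n hd, Finset.sum_mul, map_sum]
  refine Finset.sum_eq_zero fun i hi => ?_
  rw [← C_mul_X_pow_eq_monomial, mul_assoc, ← smul_eq_C_mul, map_smul,
    moment_X_pow_mul_eq_zero hα hP i (Finset.mem_range.mp hi), smul_zero]

/-- An eigenpolynomial of the Gegenbauer operator of degree less than the eigenvalue index is zero. -/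
lemma eq_zero_of_diffOp_eq {α : ℝ} (hα : -1 < α) {n : ℕ} {P : ℝ[X]}
    (hP : diffOp α P = C (-(n * (n + 2 * α + 1) : ℝ)) * P) (hd : P.degree < n) : P = 0 := by
  by_contra h0
  have h1 := moment_mul_eq_zero hα hP hd
  have h2 := moment_pos hα (mul_ne_zero h0 h0) fun x _ => by
    rw [eval_mul]; exact mul_self_nonneg _
  linarith

end Moment

/-! ### The differential equation and leading coefficient of the Jacobi polynomial. -/

lemma diffOp_add (α : ℝ) (p q : ℝ[X]) : diffOp α (p + q) = diffOp α p + diffOp α q := by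
  simp only [diffOp, derivative_add]; ring

lemma diffOp_C_mul (α c : ℝ) (p : ℝ[X]) : diffOp α (C c * p) = C c * diffOp α p := by
  simp only [diffOp, derivative_C_mul]; ring

lemma diffOp_sum {ι : Type*} (α : ℝ) (s : Finset ι) (f : ι → ℝ[X]) :
    diffOp α (∑ i ∈ s, f i) = ∑ i ∈ s, diffOp α (f i) := by
  classical
  induction s using Finset.induction_on with
  | empty => simp [diffOp]
  | insert a s ha ih => rw [Finset.sum_insert ha, Finset.sum_insert ha, diffOp_add, ih]

lemma binom_succ (r : ℝ) (k : ℕ) : (k + 1) * binom r (k + 1) = (r - k) * binom r k := by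
  have h : (k.factorial : ℝ) ≠ 0 := by positivity
  simp only [binom, descPochhammer_succ_right, Nat.factorial_succ]
  simp
  field_simp

/-- The terms of the defining sum of `jacobi n α α`, up to the coefficients. -/
noncomputable def jacobiTerm (s t : ℕ) : ℝ[X] :=
  (C (1 / 2) * (X - 1)) ^ s * (C (1 / 2) * (X + 1)) ^ t

/-- With a = (x-1)/2 and b = (x+1)/2 one has 1-x² = -4ab and x = a+b, so the operator preserves the
total degree s+t in a, b. Where s-1 or t-1 is truncated, the coefficient is zero. -/
lemma diffOp_jacobiTerm (α : ℝ) (s t : ℕ) :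
    diffOp α (jacobiTerm s t) =
      -(C (s * (s + α)) * jacobiTerm (s - 1) (t + 1) +
        C (2 * s * t + (α + 1) * (s + t)) * jacobiTerm s t +
        C (t * (t + α)) * jacobiTerm (s + 1) (t - 1)) := by
  have h3 : C (1 / 2 : ℝ) * 2 = 1 := by
    rw [show (2 : ℝ[X]) = C 2 from rfl, ← C_mul]; norm_num
  have ha : derivative (C (1 / 2 : ℝ) * (X - 1)) = C (1 / 2) := by simp
  have hb : derivative (C (1 / 2 : ℝ) * (X + 1)) = C (1 / 2) := by simp
  have h1 : (1 - X ^ 2 : ℝ[X]) = -(4 * (C (1 / 2) * (X - 1)) * (C (1 / 2) * (X + 1))) := by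
    linear_combination (1 - X ^ 2) * (2 * C (1 / 2) + 1) * h3.symm
  have h2 : (X : ℝ[X]) = C (1 / 2) * (X - 1) + C (1 / 2) * (X + 1) := by
    linear_combination X * h3.symm
  have hC : C (2 * α + 2) = 2 * C (α + 1) := by
    rw [show (2 : ℝ[X]) = C 2 from rfl, ← C_mul]; congr 1; ring
  rw [diffOp, jacobiTerm, h1, hC]
  simp only [jacobiTerm]
  generalize C (1 / 2 : ℝ) * (X - 1) = a at *
  generalize C (1 / 2 : ℝ) * (X + 1) = b at *
  rw [h2]
  generalize C (1 / 2 : ℝ) = h at *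
  have hd : ∀ s t : ℕ, derivative (a ^ s * b ^ t) =
      h * (s * a ^ (s - 1) * b ^ t + t * a ^ s * b ^ (t - 1)) := by
    intro s t
    rw [derivative_mul, derivative_pow, derivative_pow, ha, hb]
    simp only [map_natCast]
    ring
  have hd2 : derivative (derivative (a ^ s * b ^ t)) =
      h ^ 2 * (s * ((s - 1 : ℕ) * a ^ (s - 1 - 1) * b ^ t + t * a ^ (s - 1) * b ^ (t - 1)) +
        t * (s * a ^ (s - 1) * b ^ (t - 1) + (t - 1 : ℕ) * a ^ s * b ^ (t - 1 - 1))) := by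
    have hh : derivative h = 0 := by
      have := congrArg derivative h3
      rw [derivative_mul, derivative_ofNat, derivative_one, mul_zero, add_zero] at this
      simpa using this
    rw [hd, derivative_mul, hh, derivative_add, mul_assoc, mul_assoc, derivative_natCast_mul,
      derivative_natCast_mul, hd, hd]
    ring
  rw [hd2, hd]
  have hs : (4 * h ^ 2 : ℝ[X]) = 1 := by linear_combination (2 * h + 1) * h3
  generalize hF2 : ((s : ℝ[X]) * ((s - 1 : ℕ) * a ^ (s - 1 - 1) * b ^ t +
    t * a ^ (s - 1) * b ^ (t - 1)) + t * (s * a ^ (s - 1) * b ^ (t - 1) +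
      (t - 1 : ℕ) * a ^ s * b ^ (t - 1 - 1))) = F2
  generalize hF1 : ((s : ℝ[X]) * a ^ (s - 1) * b ^ t + t * a ^ s * b ^ (t - 1)) = F1
  suffices -(a * b) * F2 - C (α + 1) * (a + b) * F1 =
      -(C (s * (s + α)) * (a ^ (s - 1) * b ^ (t + 1)) +
        C (2 * s * t + (α + 1) * (s + t)) * (a ^ s * b ^ t) +
        C (t * (t + α)) * (a ^ (s + 1) * b ^ (t - 1))) by
    linear_combination this - a * b * F2 * hs - C (α + 1) * (a + b) * F1 * h3
  rw [← hF2, ← hF1]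
  simp only [C_mul, C_add, C_1, map_natCast, map_ofNat]
  rcases s with _ | _ | s <;> rcases t with _ | _ | t <;> simp <;> ring

/-- The ratio of consecutive binomial coefficients lets both off-diagonal sums be reindexed onto the
diagonal. There the coefficients add up to the eigenvalue, independently of s. -/
lemma diffOp_jacobi (n : ℕ) (α : ℝ) :
    diffOp α (jacobi n α α) = C (-(n * (n + 2 * α + 1) : ℝ)) * jacobi n α α := by
  set c : ℕ → ℝ := fun s => binom (n + α) (n - s) * binom (n + α) s with hc
  have hJ : jacobi n α α = ∑ s ∈ Finset.range (n + 1), C (c s) * jacobiTerm s (n - s) := rfl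
  have hrec : ∀ s < n, (s + 1) * (s + 1 + α) * c (s + 1) =
      ((n - s : ℕ) : ℝ) * ((n - s : ℕ) + α) * c s := by
    intro s hs
    obtain ⟨t, rfl⟩ := Nat.exists_eq_add_of_lt hs
    have h1 := binom_succ ((s + t + 1 : ℕ) + α) s
    have h2 := binom_succ ((s + t + 1 : ℕ) + α) t
    simp only [hc, show s + t + 1 - (s + 1) = t by omega, show s + t + 1 - s = t + 1 by omega]
    push_cast at h1 h2 ⊢
    linear_combination (s + 1 + α) * binom (s + t + 1 + α) t * h1 -
      (t + 1 + α) * binom (s + t + 1 + α) s * h2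
  clear_value c
  rw [hJ, diffOp_sum, Finset.mul_sum]
  simp only [diffOp_C_mul, diffOp_jacobiTerm]
  have e1 : ∑ s ∈ Finset.range (n + 1), C (c s * (s * (s + α))) * jacobiTerm (s - 1) (n - s + 1) =
      ∑ s ∈ Finset.range (n + 1),
        C (c s * ((n - s : ℕ) * ((n - s : ℕ) + α))) * jacobiTerm s (n - s) := by
    rw [Finset.sum_range_succ', Finset.sum_range_succ _ n]
    congr 1
    · refine Finset.sum_congr rfl fun s hs => ?_
      have hs' := Finset.mem_range.mp hs
      have := hrec s hs'
      rw [Nat.add_sub_cancel, show n - (s + 1) + 1 = n - s by omega]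
      congr 2
      push_cast
      linear_combination this
    · simp
  have e2 : ∑ s ∈ Finset.range (n + 1),
        C (c s * ((n - s : ℕ) * ((n - s : ℕ) + α))) * jacobiTerm (s + 1) (n - s - 1) =
      ∑ s ∈ Finset.range (n + 1), C (c s * (s * (s + α))) * jacobiTerm s (n - s) := by
    rw [Finset.sum_range_succ, Finset.sum_range_succ' _ n]
    congr 1
    · refine Finset.sum_congr rfl fun s hs => ?_
      have hs' := Finset.mem_range.mp hs
      have := hrec s hs'
      rw [show n - (s + 1) = n - s - 1 by omega]
      congr 2
      push_cast
      linear_combination -this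
    · simp
  calc _ = -(∑ s ∈ Finset.range (n + 1),
              C (c s * (s * (s + α))) * jacobiTerm (s - 1) (n - s + 1)) -
          ∑ s ∈ Finset.range (n + 1), C (c s * (2 * s * (n - s : ℕ) +
            (α + 1) * (s + (n - s : ℕ)))) * jacobiTerm s (n - s) -
          ∑ s ∈ Finset.range (n + 1), C (c s * ((n - s : ℕ) * ((n - s : ℕ) + α))) *
            jacobiTerm (s + 1) (n - s - 1) := by
        rw [← Finset.sum_neg_distrib, ← Finset.sum_sub_distrib, ← Finset.sum_sub_distrib]
        refine Finset.sum_congr rfl fun s _ => ?_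
        simp only [C_mul]; ring
    _ = _ := by
        rw [e1, e2, ← Finset.sum_neg_distrib, ← Finset.sum_sub_distrib, ← Finset.sum_sub_distrib]
        refine Finset.sum_congr rfl fun s hs => ?_
        have hs' : s ≤ n := Nat.lt_succ_iff.mp (Finset.mem_range.mp hs)
        rw [← neg_mul, ← sub_mul, ← sub_mul, ← C_neg, ← C_sub, ← C_sub, ← mul_assoc (C _) (C _), ← C_mul]
        congr 2
        rw [Nat.cast_sub hs']
        ring

lemma natDegree_jacobi_le (n : ℕ) (α : ℝ) : (jacobi n α α).natDegree ≤ n := by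
  refine natDegree_sum_le_of_forall_le _ _ fun s hs => ?_
  have hs' : s ≤ n := Nat.lt_succ_iff.mp (Finset.mem_range.mp hs)
  have h1 : (C (1 / 2 : ℝ) * (X - 1)).natDegree ≤ 1 := by compute_degree
  have h2 : (C (1 / 2 : ℝ) * (X + 1)).natDegree ≤ 1 := by compute_degree
  refine (natDegree_C_mul_le _ _).trans (natDegree_mul_le.trans ?_)
  have := natDegree_pow_le_of_le s h1
  have := natDegree_pow_le_of_le (n - s) h2
  omega

lemma binom_eq_choose (r : ℝ) (k : ℕ) : binom r k = Ring.choose r k := by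
  rw [Ring.choose_eq_smul, binom, descPochhammer_smeval_eq_ascPochhammer,
    descPochhammer_eval_eq_ascPochhammer, ascPochhammer_smeval_eq_eval, smul_eq_mul,
    div_eq_inv_mul]

/-- Each term contributes its binomial product times 2^{-n}; the Vandermonde identity sums these
products. -/
lemma coeff_jacobi (n : ℕ) (α : ℝ) : (jacobi n α α).coeff n = binom (2 * n + 2 * α) n / 2 ^ n := by
  have hv : binom (2 * n + 2 * α) n =
      ∑ s ∈ Finset.range (n + 1), binom (n + α) (n - s) * binom (n + α) s := by
    simp only [binom_eq_choose]
    rw [show 2 * n + 2 * α = (n + α) + (n + α) by ring,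
      Ring.add_choose_eq n (Commute.all _ _), Finset.Nat.sum_antidiagonal_eq_sum_range_succ_mk]
    exact Finset.sum_congr rfl fun s _ => mul_comm _ _
  rw [hv, jacobi, finsetSum_coeff, Finset.sum_div]
  refine Finset.sum_congr rfl fun s hs => ?_
  have hs' : s ≤ n := Nat.lt_succ_iff.mp (Finset.mem_range.mp hs)
  have h1 : (C (1 / 2 : ℝ) * (X - 1)).natDegree ≤ 1 := by compute_degree
  have h2 : (C (1 / 2 : ℝ) * (X + 1)).natDegree ≤ 1 := by compute_degree
  have h3 : ∀ (m : ℕ) (p : ℝ[X]), p.natDegree ≤ 1 → (p ^ m).coeff m = p.coeff 1 ^ m := by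
    intro m p hp
    simpa using coeff_pow_of_natDegree_le (m := m) hp
  have h4 := coeff_mul_add_eq_of_natDegree_le (hdf := (natDegree_pow_le_of_le s h1).trans (mul_one s).le)
    (hdg := (natDegree_pow_le_of_le (n - s) h2).trans (mul_one _).le)
  rw [Nat.add_sub_cancel' hs', h3 _ _ h1, h3 _ _ h2] at h4
  rw [coeff_C_mul, h4]
  simp only [coeff_C_mul, coeff_sub, coeff_add, coeff_X_one, coeff_one]
  norm_num
  rw [← pow_add, Nat.add_sub_cancel' hs', div_pow, one_pow, mul_one_div]

/-! ### The Chebyshev expansion of the Jacobi polynomial. -/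

lemma g_zero (n : ℕ) (α : ℝ) : g n α 0 = 1 := by simp [g]

lemma g_succ {n : ℕ} {α : ℝ} (hα : -1 < α) (h : α ≠ -1 / 2) (k : ℕ) :
    (k + 1) * g n α (k + 1) = (k + α + 1 / 2) * g n α k := by
  have h0 : α + 1 / 2 ≠ 0 := fun h' => h (by linarith)
  have hG : Real.Gamma (α + 1 / 2) ≠ 0 := by
    refine Real.Gamma_ne_zero fun m => ?_
    rcases m.eq_zero_or_pos with rfl | hm
    · simpa using h0
    · have : (1 : ℝ) ≤ m := by exact_mod_cast hm
      intro h'; linarith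
  have hf : (k.factorial : ℝ) ≠ 0 := by positivity
  rcases k.eq_zero_or_pos with rfl | hk
  · simp only [g, if_neg h]
    rw [show ((0 + 1 : ℕ) : ℝ) + α + 1 / 2 = (α + 1 / 2) + 1 by push_cast; ring,
      Real.Gamma_add_one h0]
    simp only [Nat.factorial_one, Nat.cast_one, Nat.cast_zero, zero_add, one_mul]
    simpa using mul_div_cancel_right₀ _ hG
  · have h1 : (1 : ℝ) ≤ k := by exact_mod_cast hk
    simp only [g, if_neg h, hk.ne', if_false, Nat.succ_ne_zero, Nat.factorial_succ]
    rw [show ((k + 1 : ℕ) : ℝ) + α + 1 / 2 = (k + α + 1 / 2) + 1 by push_cast; ring,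
      Real.Gamma_add_one (by linarith)]
    push_cast
    field_simp

/-- This is the form of the recurrence that also survives α = -1/2, where both sides vanish. It is
all that the differential equation needs, so the exceptional case is not treated separately there.
-/
lemma g_mul_g_succ {n : ℕ} {α : ℝ} (hα : -1 < α) {k : ℕ} (hk : k < n) :
    (k + 1) * (n - k - 1 + (α + 1 / 2)) * (g n α (k + 1) * g n α (n - (k + 1))) =
      (n - k) * (k + (α + 1 / 2)) * (g n α k * g n α (n - k)) := by
  obtain ⟨j, rfl⟩ := Nat.exists_eq_add_of_lt hk
  rw [show k + j + 1 - (k + 1) = j by omega, show k + j + 1 - k = j + 1 by omega]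
  by_cases h : α = -1 / 2
  · subst h
    norm_num [g]
    rcases k.eq_zero_or_pos with rfl | hk
    · rcases j.eq_zero_or_pos with rfl | hj
      · simp
      · simp [hj.ne']
    · rcases j.eq_zero_or_pos with rfl | hj
      · simp only [add_zero, if_true]; simp +contextual
      · simp [hk.ne', hj.ne']
  · have h1 := g_succ (n := k + j + 1) hα h k
    have h2 := g_succ (n := k + j + 1) hα h j
    push_cast
    linear_combination (j + (α + 1 / 2)) * g (k + j + 1) α j * h1 -
      (k + α + 1 / 2) * g (k + j + 1) α k * h2

lemma g_ne_zero {n : ℕ} {α : ℝ} (hα : -1 < α) : g n α n ≠ 0 := by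
  by_cases h : α = -1 / 2
  · simp [g, h]
  · rw [g, if_neg h]
    split_ifs with hn
    · exact one_ne_zero
    have h0 : α + 1 / 2 ≠ 0 := fun h' => h (by linarith)
    have hn' : (1 : ℝ) ≤ n := by exact_mod_cast Nat.one_le_iff_ne_zero.mpr hn
    refine div_ne_zero (Real.Gamma_pos_of_pos (by linarith)).ne' (mul_ne_zero (by positivity)
      (Real.Gamma_ne_zero fun m => ?_))
    rcases m.eq_zero_or_pos with rfl | hm
    · simpa using h0
    · have : (1 : ℝ) ≤ m := by exact_mod_cast hm
      intro h'; linarith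

/-- The Chebyshev expansion of the Gegenbauer polynomial, up to the factor `A n α`. -/
noncomputable def chebSum (n : ℕ) (α : ℝ) : ℝ[X] :=
  ∑ k ∈ Finset.range (n + 1), C (g n α k * g n α (n - k)) * Chebyshev.T ℝ (n - 2 * k : ℤ)

lemma two_mul_T (m : ℤ) : 2 * Chebyshev.T ℝ m = Chebyshev.U ℝ m - Chebyshev.U ℝ (m - 2) := by
  simpa using Chebyshev.two_mul_T_eq_U_sub_U (R := ℝ) (m - 2)

/-- The defect from being an eigenfunction is split between U_{n-2k} and U_{n-2(k+1)} so that the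
weighted sum over k telescopes. -/
lemma diffOp_T (α : ℝ) (n k : ℤ) :
    diffOp α (Chebyshev.T ℝ (n - 2 * k)) =
      C (-(n * (n + 2 * α + 1) : ℝ)) * Chebyshev.T ℝ (n - 2 * k) +
      2 * (C (k * (n - k + (α + 1 / 2)) : ℝ) * Chebyshev.U ℝ (n - 2 * k) -
        C ((n - k) * (k + (α + 1 / 2)) : ℝ) * Chebyshev.U ℝ (n - 2 * (k + 1))) := by
  have h1 := Chebyshev.one_sub_X_sq_mul_derivative_derivative_T_eq_poly_in_T (R := ℝ) (n - 2 * k)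
  have h2 := Chebyshev.T_derivative_eq_U (R := ℝ) (n - 2 * k)
  have h3 := Chebyshev.T_eq_U_sub_X_mul_U ℝ (n - 2 * k)
  have h4 := two_mul_T (n - 2 * k)
  rw [show n - 2 * k - 2 = n - 2 * (k + 1) by ring] at h4
  rw [Function.iterate_succ, Function.iterate_one, Function.comp_apply] at h1
  have hhalf : C (1 / 2 : ℝ) * 2 = 1 := by
    rw [show (2 : ℝ[X]) = C 2 from rfl, ← C_mul]; norm_num
  rw [diffOp, h1, h2]
  generalize Chebyshev.T ℝ (n - 2 * k) = T at *
  generalize Chebyshev.U ℝ (n - 2 * k) = U at *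
  generalize Chebyshev.U ℝ (n - 2 * (k + 1)) = V at *
  generalize Chebyshev.U ℝ (n - 2 * k - 1) = W at *
  simp only [C_neg, C_mul, C_add, C_sub, map_intCast, map_ofNat, map_one]
  generalize C (1 / 2 : ℝ) = h at *
  push_cast
  linear_combination (-(2 * C α + 1) * (n - 2 * k)) * h3 + 2 * (n - k) * (k + (C α + h)) * h4 -
    (k * U - (n - k) * (U - 2 * T)) * hhalf

/-- The defects telescope by `g_mul_g_succ`; the end terms vanish because of the factors k at k = 0
and n-k at k = n. -/
lemma diffOp_chebSum {α : ℝ} (hα : -1 < α) (n : ℕ) :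
    diffOp α (chebSum n α) = C (-(n * (n + 2 * α + 1) : ℝ)) * chebSum n α := by
  set t : ℕ → ℝ[X] := fun k =>
    2 * (C (k * (n - k + (α + 1 / 2)) * (g n α k * g n α (n - k)) : ℝ) *
      Chebyshev.U ℝ (n - 2 * k : ℤ)) with ht
  rw [chebSum, diffOp_sum, Finset.mul_sum, ← sub_eq_zero, ← Finset.sum_sub_distrib,
    Finset.sum_range_succ]
  have h : ∀ k ∈ Finset.range n, diffOp α (C (g n α k * g n α (n - k)) *
      Chebyshev.T ℝ (n - 2 * k : ℤ)) - C (-(n * (n + 2 * α + 1) : ℝ)) *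
        (C (g n α k * g n α (n - k)) * Chebyshev.T ℝ (n - 2 * k : ℤ)) = t k - t (k + 1) := by
    intro k hk
    have hg := congrArg (C : ℝ → ℝ[X]) (g_mul_g_succ hα (Finset.mem_range.mp hk))
    have hT := diffOp_T α n k
    rw [diffOp_C_mul, ht]
    push_cast at hT ⊢
    rw [hT]
    simp only [sub_add_eq_sub_sub, C_mul, C_add, C_sub] at hg ⊢
    linear_combination 2 * Chebyshev.U ℝ (n - 2 * (k + 1) : ℤ) * hg
  rw [Finset.sum_congr rfl h, Finset.sum_range_sub', diffOp_C_mul]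
  have hT := diffOp_T α n n
  push_cast at hT
  rw [hT]
  simp only [ht, sub_self, zero_mul, C_0, zero_add, sub_zero, Nat.cast_zero, mul_zero]
  simp only [C_mul]
  ring

lemma natDegree_T_le {n k : ℕ} (hk : k ≤ n) :
    (Chebyshev.T ℝ (n - 2 * k : ℤ)).natDegree ≤ n := by
  rw [Chebyshev.natDegree_T]; omega

lemma natDegree_chebSum_le (n : ℕ) (α : ℝ) : (chebSum n α).natDegree ≤ n := by
  refine natDegree_sum_le_of_forall_le _ _ fun k hk => ?_
  exact (natDegree_C_mul_le _ _).trans (natDegree_T_le (Nat.lt_succ_iff.mp (Finset.mem_range.mp hk)))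

/-- Only k = 0 and k = n reach degree n, as T_{-n} = T_n. They are distinct for n ≥ 1, and each
contributes 2^{n-1}. -/
lemma coeff_chebSum {n : ℕ} (hn : 1 ≤ n) (α : ℝ) : (chebSum n α).coeff n = g n α n * 2 ^ n := by
  have h1 : (Chebyshev.T ℝ (n : ℤ)).coeff n = 2 ^ (n - 1) := by
    have := Chebyshev.leadingCoeff_T ℝ (n : ℤ)
    rwa [leadingCoeff, Chebyshev.natDegree_T, Int.natAbs_natCast] at this
  obtain ⟨m, rfl⟩ := Nat.exists_eq_add_of_le' hn
  have h0 : ∀ k ∈ Finset.range m, (C (g (m + 1) α (k + 1) * g (m + 1) α (m + 1 - (k + 1))) *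
      Chebyshev.T ℝ ((m + 1 : ℕ) - 2 * (k + 1 : ℕ) : ℤ)).coeff (m + 1) = 0 := by
    intro k hk
    have hk' := Finset.mem_range.mp hk
    rw [coeff_C_mul, coeff_eq_zero_of_natDegree_lt, mul_zero]
    rw [Chebyshev.natDegree_T]; omega
  have h2 : Chebyshev.T ℝ ((m + 1 : ℕ) - 2 * (m + 1 : ℕ) : ℤ) = Chebyshev.T ℝ ((m + 1 : ℕ) : ℤ) := by
    rw [← Chebyshev.T_neg]; congr 1; ring
  rw [chebSum, finsetSum_coeff, Finset.sum_range_succ, Finset.sum_range_succ',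
    Finset.sum_eq_zero h0, h2]
  simp only [Nat.cast_zero, mul_zero, sub_zero, coeff_C_mul, h1, g_zero, Nat.sub_self,
    Nat.sub_zero]
  simp [pow_succ]
  ring

lemma binom_eq_Gamma {r : ℝ} {n : ℕ} (h : 0 < r - n + 1) :
    binom r n = Real.Gamma (r + 1) / (Real.Gamma (r - n + 1) * n.factorial) := by
  have hf : (n.factorial : ℝ) ≠ 0 := by positivity
  have key : ∀ k : ℕ, k ≤ n → (descPochhammer ℝ k).eval r * Real.Gamma (r - k + 1) =
      Real.Gamma (r + 1) := by
    intro k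
    induction k with
    | zero => simp
    | succ k ih =>
      intro hk
      have hk' : (k : ℝ) + 1 ≤ n := by exact_mod_cast hk
      rw [← ih (by omega), descPochhammer_succ_right]
      push_cast
      rw [show r - (k + 1) + 1 = r - k by ring, Real.Gamma_add_one (s := r - k) (by linarith)]
      simp
      ring
  rw [binom, ← key n le_rfl]
  have := (Real.Gamma_pos_of_pos h).ne'
  field_simp

/-- Equality of leading coefficients, by Legendre's duplication formula at n+α+1/2 and, when α ≠
-1/2, also at α+1/2. -/
lemma A_mul_g {n : ℕ} (hn : 1 ≤ n) {α : ℝ} (hα : -1 < α) :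
    A n α * (g n α n * 2 ^ n) = binom (2 * n + 2 * α) n / 2 ^ n := by
  have hn' : (1 : ℝ) ≤ n := by exact_mod_cast hn
  rw [binom_eq_Gamma (by linarith)]
  have hd := Real.Gamma_mul_Gamma_add_half (n + α + 1 / 2)
  have hf : (n.factorial : ℝ) ≠ 0 := by positivity
  have hpi : √Real.pi ≠ 0 := (Real.sqrt_pos.mpr Real.pi_pos).ne'
  have h3 : Real.Gamma (n + 2 * α + 1) ≠ 0 := (Real.Gamma_pos_of_pos (by linarith)).ne'
  rw [show n + α + 1 / 2 + 1 / 2 = n + α + 1 by ring,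
    show 2 * (n + α + 1 / 2) = 2 * n + 2 * α + 1 by ring,
    show 1 - (2 * n + 2 * α + 1) = -(2 * α) - (n + n) by ring, Real.rpow_sub two_pos,
    Real.rpow_add two_pos, Real.rpow_natCast] at hd
  rw [show 2 * n + 2 * α - n + 1 = n + 2 * α + 1 by ring]
  by_cases h : α = -1 / 2
  · subst h
    rw [A, if_pos rfl]
    simp only [g, if_true, or_true]
    rw [show (n : ℝ) + -1 / 2 + 1 = n + 1 / 2 by ring,
      show (n : ℝ) + -1 / 2 + 1 / 2 = n by ring] at hd
    rw [show (n : ℝ) + 2 * (-1 / 2) + 1 = n by ring] at h3 ⊢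
    generalize Real.Gamma (n + 1 / 2) = a at *
    generalize Real.Gamma (2 * n + 2 * (-1 / 2) + 1) = b at *
    norm_num at hd
    field_simp
    field_simp at hd
    linear_combination hd
  · have hd2 := Real.Gamma_mul_Gamma_add_half (α + 1 / 2)
    rw [show α + 1 / 2 + 1 / 2 = α + 1 by ring, show 2 * (α + 1 / 2) = 2 * α + 1 by ring,
      show 1 - (2 * α + 1) = -(2 * α) by ring] at hd2
    have hg := g_ne_zero (n := n) hα
    rw [g, if_neg h, if_neg (by omega)] at hg
    have h4 : Real.Gamma (α + 1 / 2) ≠ 0 := fun h' => hg (by rw [h']; simp)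
    have h5 : Real.Gamma (α + 1) ≠ 0 := (Real.Gamma_pos_of_pos (by linarith)).ne'
    have h6 : (2 : ℝ) ^ (-(2 * α)) ≠ 0 := (Real.rpow_pos_of_pos two_pos _).ne'
    rw [A, if_neg h, g, if_neg h, if_neg (by omega)]
    generalize Real.Gamma (n + α + 1) = a at *
    generalize Real.Gamma (n + α + 1 / 2) = b at *
    generalize Real.Gamma (α + 1 / 2) = c at *
    generalize Real.Gamma (α + 1) = d at *
    generalize Real.Gamma (2 * n + 2 * α + 1) = e at *
    generalize (2 : ℝ) ^ (-(2 * α)) = f at *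
    field_simp
    field_simp at hd
    refine mul_right_cancel₀ (mul_ne_zero h6 hpi) ?_
    linear_combination (Real.Gamma (2 * α + 1) * f * √Real.pi) * hd - e * f * √Real.pi * hd2

lemma jacobi_eq {n : ℕ} (hn : 1 ≤ n) {α : ℝ} (hα : -1 < α) :
    jacobi n α α = C (A n α) * chebSum n α := by
  rw [← sub_eq_zero]
  refine eq_zero_of_diffOp_eq hα (n := n) ?_ ?_
  · rw [sub_eq_add_neg, ← neg_mul, ← C_neg, diffOp_add, diffOp_C_mul, diffOp_jacobi,
      diffOp_chebSum hα]
    ring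
  · rw [degree_lt_iff_coeff_zero]
    intro m hm
    rcases hm.eq_or_lt with rfl | hm
    · rw [coeff_sub, coeff_C_mul, coeff_chebSum hn, coeff_jacobi, A_mul_g hn hα, sub_self]
    · rw [coeff_eq_zero_of_natDegree_lt]
      refine (natDegree_sub_le _ _).trans_lt (max_lt ?_ ?_)
      · exact (natDegree_jacobi_le n α).trans_lt hm
      · exact ((natDegree_C_mul_le _ _).trans (natDegree_chebSum_le n α)).trans_lt hm

/-! ### Zeros of the Jacobi polynomial and exactness of Gauss quadrature. -/

section Roots

variable {n : ℕ} {α : ℝ}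

lemma A_ne_zero (hn : 1 ≤ n) (hα : -1 < α) : A n α ≠ 0 := by
  have hn' : (1 : ℝ) ≤ n := by exact_mod_cast hn
  intro h
  have h1 := A_mul_g hn hα
  rw [h, zero_mul, binom_eq_Gamma (by linarith)] at h1
  have h2 := Real.Gamma_pos_of_pos (s := 2 * n + 2 * α + 1) (by linarith)
  have h3 := Real.Gamma_pos_of_pos (s := 2 * n + 2 * α - n + 1) (by linarith)
  have : 0 < Real.Gamma (2 * n + 2 * α + 1) /
    (Real.Gamma (2 * n + 2 * α - n + 1) * n.factorial) / 2 ^ n := by positivity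
  linarith

lemma coeff_jacobi_ne_zero (hn : 1 ≤ n) (hα : -1 < α) : (jacobi n α α).coeff n ≠ 0 := by
  rw [jacobi_eq hn hα, coeff_C_mul, coeff_chebSum hn]
  exact mul_ne_zero (A_ne_zero hn hα) (mul_ne_zero (g_ne_zero hα) (by positivity))

lemma jacobi_ne_zero (hn : 1 ≤ n) (hα : -1 < α) : jacobi n α α ≠ 0 := fun h =>
  coeff_jacobi_ne_zero hn hα (by rw [h, coeff_zero])

lemma natDegree_jacobi (hn : 1 ≤ n) (hα : -1 < α) : (jacobi n α α).natDegree = n :=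
  natDegree_eq_of_le_of_coeff_ne_zero (natDegree_jacobi_le n α) (coeff_jacobi_ne_zero hn hα)

lemma degree_jacobi (hn : 1 ≤ n) (hα : -1 < α) : (jacobi n α α).degree = n := by
  rw [degree_eq_natDegree (jacobi_ne_zero hn hα), natDegree_jacobi hn hα]

lemma moment_mul_jacobi (hα : -1 < α) {q : ℝ[X]} (hq : q.degree < n) :
    moment α hα (q * jacobi n α α) = 0 :=
  moment_mul_eq_zero hα (diffOp_jacobi n α) hq

/-- No nonconstant polynomial that is nonnegative on the interval divides `jacobi n α α`. -/
lemma not_dvd_jacobi (hn : 1 ≤ n) (hα : -1 < α) {D : ℝ[X]} (hD : 0 < D.degree)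
    (h : ∀ x ∈ Set.Ioo (-1 : ℝ) 1, 0 ≤ D.eval x) : ¬ D ∣ jacobi n α α := by
  rintro ⟨q, hq⟩
  have h0 := jacobi_ne_zero hn hα
  have hq0 : q ≠ 0 := by rintro rfl; simp [hq] at h0
  have hD0 : D ≠ 0 := by rintro rfl; simp at hD
  have hd : q.degree < n := by
    rw [← degree_jacobi hn hα, hq, degree_mul, degree_eq_natDegree hq0, degree_eq_natDegree hD0]
    rw [degree_eq_natDegree hD0] at hD
    norm_cast at hD ⊢
    omega
  have h1 := moment_mul_jacobi hα hd
  -- If J_n = Dq, then ∫ q J_n ω = ∫ D q² ω would be both zero and positive.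
  have h2 := moment_pos hα (mul_ne_zero hD0 (mul_ne_zero hq0 hq0)) fun x hx => by
    rw [eval_mul, eval_mul]; exact mul_nonneg (h x hx) (mul_self_nonneg _)
  rw [hq, show q * (D * q) = D * (q * q) by ring] at h1
  linarith

/-- A zero elsewhere would give a divisor that is nonnegative on the interval: ±(X - x) for real x
outside it, or (X - z)(X - z̄) for nonreal z. -/
lemma exists_of_aeval_jacobi_eq_zero (hn : 1 ≤ n) (hα : -1 < α) {z : ℂ}
    (hz : aeval z (jacobi n α α) = 0) : ∃ x ∈ Set.Ioo (-1 : ℝ) 1, (x : ℂ) = z := by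
  by_cases him : z.im = 0
  · obtain ⟨x, rfl⟩ : ∃ x : ℝ, (x : ℂ) = z := ⟨z.re, Complex.ext rfl (by simpa using him.symm)⟩
    have hx : (jacobi n α α).eval x = 0 := by
      rw [← Complex.coe_algebraMap, aeval_algebraMap_apply] at hz
      simpa using hz
    have hdvd := dvd_iff_isRoot.mpr hx
    refine ⟨x, ⟨?_, ?_⟩, rfl⟩ <;> by_contra! hlt
    · refine not_dvd_jacobi hn hα (by rw [degree_X_sub_C]; norm_num) (fun y hy => ?_) hdvd
      simp only [eval_sub, eval_X, eval_C]
      linarith [hy.1]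
    · refine not_dvd_jacobi hn hα (D := -(X - C x)) (by rw [degree_neg, degree_X_sub_C]; norm_num)
        (fun y hy => ?_) (neg_dvd.mpr hdvd)
      simp only [eval_neg, eval_sub, eval_X, eval_C]
      linarith [hy.2]
  · refine absurd (quadratic_dvd_of_aeval_eq_zero_im_ne_zero _ hz him)
      (not_dvd_jacobi hn hα ?_ fun x _ => ?_)
    · rw [show (X ^ 2 - C (2 * z.re) * X + C (‖z‖ ^ 2) : ℝ[X]).degree = 2 by compute_degree!]
      norm_num
    · rw [← Complex.normSq_eq_norm_sq, Complex.normSq_apply]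
      simp only [eval_add, eval_sub, eval_mul, eval_pow, eval_X, eval_C]
      nlinarith [sq_nonneg (x - z.re), sq_nonneg z.im]

lemma nodup_roots_jacobi (hn : 1 ≤ n) (hα : -1 < α) : (jacobi n α α).roots.Nodup := by
  classical
  rw [Multiset.nodup_iff_count_le_one]
  intro a
  by_contra! h
  rw [count_roots] at h
  have h1 : (X - C a) ^ 2 ∣ jacobi n α α :=
    (pow_dvd_pow _ h).trans (pow_rootMultiplicity_dvd _ _)
  refine not_dvd_jacobi hn hα ?_ (fun x _ => ?_) h1
  · rw [degree_pow, degree_X_sub_C]; norm_num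
  · rw [eval_pow]; positivity

/-- The cofactor left after removing the real roots has no real root; a complex root of it would be
a root of J_n, hence real. So the cofactor is constant. -/
lemma card_nodes (hn : 1 ≤ n) (hα : -1 < α) : (nodes n α).card = n := by
  classical
  obtain ⟨q, hq, hdeg, hroots⟩ := exists_prod_multiset_X_sub_C_mul (jacobi n α α)
  rw [nodes, Multiset.toFinset_card_of_nodup (nodup_roots_jacobi hn hα)]
  rw [natDegree_jacobi hn hα] at hdeg
  have hq0 : q ≠ 0 := by
    rintro rfl
    exact jacobi_ne_zero hn hα (by rw [← hq, mul_zero])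
  suffices q.natDegree = 0 by omega
  by_contra h0
  obtain ⟨z, hz⟩ := IsAlgClosed.exists_aeval_eq_zero ℂ q fun h => h0 (natDegree_eq_of_degree_eq_some h)
  obtain ⟨x, -, rfl⟩ := exists_of_aeval_jacobi_eq_zero hn hα (z := z) (by rw [← hq, map_mul, hz, mul_zero])
  have hx : x ∈ q.roots := by
    rw [mem_roots hq0, IsRoot]
    rw [← Complex.coe_algebraMap, aeval_algebraMap_apply] at hz
    simpa using hz
  simp [hroots] at hx

lemma eval_jacobi_of_mem_nodes {y : ℝ} (hy : y ∈ nodes n α) : (jacobi n α α).eval y = 0 :=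
  isRoot_of_mem_roots (Multiset.mem_toFinset.mp hy)

lemma mem_Ioo_of_mem_nodes (hn : 1 ≤ n) (hα : -1 < α) {y : ℝ} (hy : y ∈ nodes n α) :
    y ∈ Set.Ioo (-1 : ℝ) 1 := by
  obtain ⟨x, hx, hxy⟩ := exists_of_aeval_jacobi_eq_zero hn hα (z := (y : ℂ)) (by
    rw [← Complex.coe_algebraMap, aeval_algebraMap_apply]
    simp [eval_jacobi_of_mem_nodes hy])
  rwa [← Complex.ofReal_injective hxy]

/-- The remainder of Gegenbauer–Gauss quadrature on real polynomials. -/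
noncomputable def quadError (n : ℕ) (α : ℝ) (hα : -1 < α) : ℝ[X] →ₗ[ℝ] ℝ :=
  moment α hα - ∑ y ∈ nodes n α, gaussWeight n α y • leval y

lemma quadError_apply (hα : -1 < α) (p : ℝ[X]) :
    quadError n α hα p = moment α hα p - ∑ y ∈ nodes n α, gaussWeight n α y * p.eval y := by
  simp [quadError]

lemma quadError_mul_jacobi (hα : -1 < α) (q : ℝ[X]) :
    quadError n α hα (q * jacobi n α α) = moment α hα (q * jacobi n α α) := by
  rw [quadError_apply, Finset.sum_eq_zero, sub_zero]
  intro y hy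
  rw [eval_mul, eval_jacobi_of_mem_nodes hy, mul_zero, mul_zero]

lemma quadError_eq_zero_of_degree_lt (hn : 1 ≤ n) (hα : -1 < α) {p : ℝ[X]} (hp : p.degree < n) :
    quadError n α hα p = 0 := by
  classical
  have h := Lagrange.eq_interpolate (s := nodes n α) (v := id) (f := p)
    Function.injective_id.injOn (by rwa [card_nodes hn hα])
  rw [quadError_apply, sub_eq_zero]
  conv_lhs => rw [h, Lagrange.interpolate_apply, map_sum]
  refine Finset.sum_congr rfl fun y _ => ?_
  rw [← smul_eq_C_mul, map_smul, smul_eq_mul, mul_comm]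
  rfl

/-- Gauss's argument: divide by J_n. The remainder is interpolated exactly, and the quotient has
degree below n, hence is orthogonal to J_n. -/
lemma quadError_eq_zero (hn : 1 ≤ n) (hα : -1 < α) {p : ℝ[X]} (hp : p.natDegree < 2 * n) :
    quadError n α hα p = 0 := by
  have h0 := jacobi_ne_zero hn hα
  have hr := degree_mod_lt p h0
  rw [degree_jacobi hn hα] at hr
  rw [← EuclideanDomain.mod_add_div p (jacobi n α α), map_add,
    quadError_eq_zero_of_degree_lt hn hα hr, zero_add, mul_comm, quadError_mul_jacobi]
  refine moment_mul_jacobi hα ?_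
  rcases lt_or_ge p.degree (jacobi n α α).degree with h | h
  · rw [(Polynomial.div_eq_zero_iff h0).mpr h]
    simp
  · have hp0 : p ≠ 0 := by
      rintro rfl
      rw [degree_zero, le_bot_iff, degree_eq_bot] at h
      exact h0 h
    have hd := degree_add_div h0 h
    rw [degree_jacobi hn hα, degree_eq_natDegree hp0] at hd
    have hq0 : p / jacobi n α α ≠ 0 := by
      intro h'
      rw [h', degree_zero] at hd
      simp at hd
    rw [degree_eq_natDegree hq0] at hd ⊢
    norm_cast at hd ⊢
    omega

end Roots

/-! ### The remainder on Chebyshev polynomials of the second kind. -/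

section Recursion

variable {n : ℕ} {α : ℝ}

lemma two_mul_T_mul_U (m a : ℤ) : 2 * Chebyshev.T ℝ a * Chebyshev.U ℝ m =
    Chebyshev.U ℝ (m + a) + Chebyshev.U ℝ (m - a) := by
  induction a using Chebyshev.induct' with
  | zero => simp; ring
  | one =>
    have := Chebyshev.U_add_one ℝ m
    rw [Chebyshev.T_one, this]; ring
  | add_two k h1 h2 =>
    have e1 := Chebyshev.U_add_two ℝ (m + k)
    have e2 := Chebyshev.U_sub_two ℝ (m - k)
    rw [Chebyshev.T_add_two]
    rw [← add_assoc] at h1 ⊢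
    rw [← sub_sub] at h1 ⊢
    linear_combination 2 * X * h1 - h2 - e1 - e2
  | neg k h => rw [Chebyshev.T_neg, h, sub_neg_eq_add, ← sub_eq_add_neg, add_comm]

/-- The product formula gives two sums, which the symmetry k ↔ n-k of the coefficients makes equal.
-/
lemma chebSum_mul_U (n : ℕ) (α : ℝ) (m : ℤ) : chebSum n α * Chebyshev.U ℝ m =
    ∑ k ∈ Finset.range (n + 1), C (g n α k * g n α (n - k)) * Chebyshev.U ℝ (m + n - 2 * k) := by
  have h2 : (2 : ℝ[X]) ≠ 0 := two_ne_zero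
  refine mul_left_cancel₀ h2 ?_
  have e : ∀ k : ℕ, 2 * (C (g n α k * g n α (n - k)) * Chebyshev.T ℝ (n - 2 * k : ℤ) *
      Chebyshev.U ℝ m) = C (g n α k * g n α (n - k)) * Chebyshev.U ℝ (m + n - 2 * k) +
        C (g n α k * g n α (n - k)) * Chebyshev.U ℝ (m - n + 2 * k) := by
    intro k
    have := two_mul_T_mul_U m (n - 2 * k)
    rw [show m + (n - 2 * k : ℤ) = m + n - 2 * k by ring,
      show m - (n - 2 * k : ℤ) = m - n + 2 * k by ring] at this
    linear_combination C (g n α k * g n α (n - k)) * this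
  rw [chebSum, Finset.sum_mul, Finset.mul_sum, Finset.sum_congr rfl fun k _ => e k,
    Finset.sum_add_distrib, two_mul]
  congr 1
  rw [← Finset.sum_range_reflect]
  refine Finset.sum_congr rfl fun k hk => ?_
  have hk' : k ≤ n := Nat.lt_succ_iff.mp (Finset.mem_range.mp hk)
  rw [show n + 1 - 1 - k = n - k by omega, show n - (n - k) = k by omega, mul_comm (g n α k)]
  congr 2
  push_cast [hk']
  ring

/-- Positivity is all that is used about γ_n: it acts as a common normalization of σ, Q_n and the
bound. -/
lemma gam_pos (hn : 1 ≤ n) (hα : -1 < α) : 0 < gam n α α := by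
  have hn' : (1 : ℝ) ≤ n := by exact_mod_cast hn
  have h1 := Real.Gamma_pos_of_pos (s := n + α + 1) (by linarith)
  have h2 := Real.Gamma_pos_of_pos (s := n + α + α + 1) (by linarith)
  have h3 : 0 < 2 * n + α + α + 1 := by linarith
  unfold gam
  positivity

lemma moment_U_mul_jacobi (hn : 1 ≤ n) (hα : -1 < α) (j : ℕ) :
    moment α hα (Chebyshev.U ℝ ((n + j : ℕ) : ℤ) * jacobi n α α) =
      gam n α α * sigma n j α α := by
  have h := (gam_pos hn hα).ne'
  rw [sigma, ← mul_assoc, mul_one_div_cancel h, one_mul, moment_apply]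
  simp only [eval_mul]

/-- The remainder of U_{n+j} J_n computed in two ways: as an integral, since the nodes contribute
nothing, and through the Chebyshev expansion of J_n. -/
lemma sum_quadError_U (hn : 1 ≤ n) (hα : -1 < α) (j : ℕ) :
    A n α * ∑ k ∈ Finset.range (n + 1), g n α k * g n α (n - k) *
      quadError n α hα (Chebyshev.U ℝ ((2 * n + j - 2 * k : ℕ) : ℤ)) =
        gam n α α * sigma n j α α := by
  rw [← moment_U_mul_jacobi hn hα, ← quadError_mul_jacobi, jacobi_eq hn hα, mul_left_comm,
    mul_comm _ (chebSum n α), chebSum_mul_U, ← smul_eq_C_mul, map_smul, map_sum, smul_eq_mul]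
  congr 1
  refine Finset.sum_congr rfl fun k hk => ?_
  have hk' : k ≤ n := Nat.lt_succ_iff.mp (Finset.mem_range.mp hk)
  rw [← smul_eq_C_mul, map_smul, smul_eq_mul]
  congr 3
  omega

lemma quadError_U_of_lt (hn : 1 ≤ n) (hα : -1 < α) {m : ℕ} (hm : m < 2 * n) :
    quadError n α hα (Chebyshev.U ℝ (m : ℤ)) = 0 :=
  quadError_eq_zero hn hα (by rwa [Chebyshev.natDegree_U_natCast])

lemma sigma_odd (hn : 1 ≤ n) (hα : -1 < α) (l : ℕ) : sigma n (2 * l + 1) α α = 0 := by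
  have hJ : ∀ x : ℝ, (jacobi n α α).eval (-x) =
      ((n : ℤ).negOnePow : ℝ) * (jacobi n α α).eval x := by
    intro x
    simp only [jacobi_eq hn hα, eval_mul, eval_C, chebSum, eval_finsetSum, Finset.mul_sum,
      Chebyshev.T_eval_neg, Int.negOnePow_sub, Int.negOnePow_two_mul, mul_one]
    exact Finset.sum_congr rfl fun k _ => by ring
  have hodd : ((n + (2 * l + 1) : ℕ) : ℤ).negOnePow * (n : ℤ).negOnePow = -1 := by
    rw [← Int.negOnePow_add]
    exact Int.negOnePow_odd _ ⟨n + l, by push_cast; ring⟩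
  have hodd' : ((((n + (2 * l + 1) : ℕ) : ℤ).negOnePow : ℤ) : ℝ) * ((n : ℤ).negOnePow : ℤ) = -1 := by
    simpa only [Units.val_mul, Int.cast_mul, Units.val_neg, Units.val_one, Int.cast_neg,
      Int.cast_one] using congrArg (fun u : ℤˣ => ((u : ℤ) : ℝ)) hodd
  rw [sigma]
  have h := intervalIntegral.integral_comp_neg (a := -1) (b := 1) fun x : ℝ =>
    (Chebyshev.U ℝ ((n + (2 * l + 1) : ℕ) : ℤ)).eval x * (jacobi n α α).eval x * weight α α x
  have hw : ∀ x : ℝ, weight α α (-x) = weight α α x := by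
    intro x; simp only [weight]; rw [sub_neg_eq_add, ← sub_eq_add_neg, mul_comm]
  simp only [Chebyshev.U_eval_neg, hJ, hw, neg_neg] at h
  have h' : ∀ x : ℝ, ((((n + (2 * l + 1) : ℕ) : ℤ).negOnePow : ℤ) : ℝ) *
      (Chebyshev.U ℝ ((n + (2 * l + 1) : ℕ) : ℤ)).eval x *
      (((n : ℤ).negOnePow : ℤ) * (jacobi n α α).eval x) * weight α α x =
      -((Chebyshev.U ℝ ((n + (2 * l + 1) : ℕ) : ℤ)).eval x * (jacobi n α α).eval x *
        weight α α x) := by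
    intro x
    linear_combination ((Chebyshev.U ℝ ((n + (2 * l + 1) : ℕ) : ℤ)).eval x *
      (jacobi n α α).eval x * weight α α x) * hodd'
  rw [intervalIntegral.integral_congr fun x _ => h' x, intervalIntegral.integral_neg] at h
  rw [neg_eq_self.mp h, mul_zero]

/-- For odd j the right side of `sum_quadError_U` is zero by parity; the later terms vanish by
induction or by exactness, leaving only k = 0. -/
lemma quadError_U_odd (hn : 1 ≤ n) (hα : -1 < α) (l : ℕ) :
    quadError n α hα (Chebyshev.U ℝ ((2 * n + (2 * l + 1) : ℕ) : ℤ)) = 0 := by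
  induction l using Nat.strong_induction_on with
  | _ l ih =>
    have h := sum_quadError_U hn hα (2 * l + 1)
    rw [sigma_odd hn hα, mul_zero, Finset.sum_range_succ', Finset.sum_eq_zero, zero_add] at h
    · simpa [A_ne_zero hn hα, g_zero, g_ne_zero hα] using h
    · intro k hk
      have hk' := Finset.mem_range.mp hk
      rcases Nat.lt_or_ge k l with hl | hl
      · rw [show 2 * n + (2 * l + 1) - 2 * (k + 1) = 2 * n + (2 * (l - (k + 1)) + 1) by omega,
          ih _ (by omega), mul_zero]
      · rw [quadError_U_of_lt hn hα (by omega), mul_zero]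

/-- Terms with k > l have degree below 2n and drop out by exactness; this is why the recursion for μ
stops at min{n, l}. -/
lemma quadError_U_even (hn : 1 ≤ n) (hα : -1 < α) (l : ℕ) :
    quadError n α hα (Chebyshev.U ℝ ((2 * n + 2 * l : ℕ) : ℤ)) = gam n α α * mu n α l := by
  induction l using Nat.strong_induction_on with
  | _ l ih =>
    have h := sum_quadError_U hn hα (2 * l)
    have hA := A_ne_zero hn hα
    have hg := g_ne_zero (n := n) hα
    have hsub : Finset.Icc 1 (min n l) ⊆ Finset.Icc 1 n :=
      Finset.Icc_subset_Icc_right (min_le_left _ _)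
    rw [Finset.sum_range_eq_add_Ico _ (by omega), Finset.Ico_add_one_right_eq_Icc,
      ← Finset.sum_subset hsub] at h
    · rw [mu_recursion, mul_sub]
      have hs : ∑ k ∈ Finset.Icc 1 (min n l), g n α k * g n α (n - k) *
          quadError n α hα (Chebyshev.U ℝ ((2 * n + 2 * l - 2 * k : ℕ) : ℤ)) =
          gam n α α * ∑ k ∈ Finset.Icc 1 (min n l), g n α k * g n α (n - k) * mu n α (l - k) := by
        rw [Finset.mul_sum]
        refine Finset.sum_congr rfl fun k hk => ?_
        have hk' := Finset.mem_Icc.mp hk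
        rw [show 2 * n + 2 * l - 2 * k = 2 * n + 2 * (l - k) by omega, ih _ (by omega)]
        ring
      rw [hs] at h
      simp only [g_zero, mul_zero, Nat.sub_zero, one_mul] at h
      field_simp
      linear_combination h
    · intro k hk hk'
      simp only [Finset.mem_Icc] at hk hk'
      rw [quadError_U_of_lt hn hα (by omega), mul_zero]

end Recursion

/-! ### Generating functions of the Chebyshev polynomials. -/

section Series

lemma hasSum_of_eq {f g : ℕ → ℂ} {a : ℂ} (hg : HasSum g a) (h : ∀ k, f k = g k) : HasSum f a := by
  rwa [funext h]

lemma abs_eval_U_le {x : ℝ} (hx : x ∈ Set.Icc (-1 : ℝ) 1) (k : ℕ) :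
    |(Chebyshev.U ℝ k).eval x| ≤ k + 1 := by
  induction k using Nat.twoStepInduction with
  | zero => simp
  | one =>
    have := abs_le.mpr hx
    simp only [Nat.cast_one, Chebyshev.U_one, eval_mul, eval_ofNat, eval_X, abs_mul]
    norm_num
    linarith
  | more k ih _ =>
    have h := congrArg (eval x) (Chebyshev.U_eq_two_mul_T_add_U ℝ k)
    have hT := Chebyshev.abs_eval_T_real_le_one (k + 2) (abs_le.mpr hx)
    simp only [eval_add, eval_mul, eval_ofNat] at h
    push_cast
    rw [h]
    rw [abs_le] at *
    constructor <;> linarith [hT.1, hT.2, ih.1, ih.2]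

lemma summable_succ_mul_pow {r : ℝ} (h0 : 0 ≤ r) (h1 : r < 1) :
    Summable fun k : ℕ => ((k : ℝ) + 1) * r ^ k := by
  have h := summable_pow_mul_geometric_of_norm_lt_one 1 (r := r) (by rwa [Real.norm_of_nonneg h0])
  simpa [add_mul] using h.add (summable_geometric_of_lt_one h0 h1)

/-- The three-term recurrence shows that the sum times 1-2xt+t² is 1, which yields the value and the
nonvanishing together. -/
lemma hasSum_U {x : ℝ} (hx : x ∈ Set.Icc (-1 : ℝ) 1) {t : ℂ} (ht : ‖t‖ < 1) :
    1 - 2 * x * t + t ^ 2 ≠ 0 ∧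
    HasSum (fun k : ℕ => (((Chebyshev.U ℝ k).eval x : ℝ) : ℂ) * t ^ k)
      (1 - 2 * x * t + t ^ 2)⁻¹ := by
  set f : ℕ → ℂ := fun k => (((Chebyshev.U ℝ k).eval x : ℝ) : ℂ) * t ^ k with hf
  have hs : Summable f := by
    refine Summable.of_norm_bounded (summable_succ_mul_pow (norm_nonneg t) ht) fun k => ?_
    rw [hf, norm_mul, norm_pow, Complex.norm_real, Real.norm_eq_abs]
    exact mul_le_mul_of_nonneg_right (abs_eval_U_le hx k) (by positivity)
  have h1 := hs.sum_add_tsum_nat_add 1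
  have h2 := hs.sum_add_tsum_nat_add 2
  have hr : ∀ k, f (k + 2) = 2 * x * t * f (k + 1) - t ^ 2 * f k := by
    intro k
    simp only [hf]
    rw [Nat.cast_add, Nat.cast_add, Nat.cast_ofNat, Nat.cast_one, Chebyshev.U_add_two]
    simp only [eval_sub, eval_mul, eval_ofNat, eval_X]
    push_cast
    ring
  have hs1 : Summable fun k => f (k + 1) := (summable_nat_add_iff 1).mpr hs
  rw [tsum_congr hr, (hs1.mul_left _).tsum_sub (hs.mul_left _), tsum_mul_left, tsum_mul_left] at h2
  have f0 : f 0 = 1 := by simp [hf]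
  have f1 : f 1 = 2 * x * t := by simp [hf]
  simp only [Finset.sum_range_succ, Finset.sum_range_zero, f0, f1] at h1 h2
  have hS : (1 - 2 * x * t + t ^ 2) * ∑' k, f k = 1 := by
    linear_combination -h2 + 2 * x * t * h1
  have hne : 1 - 2 * x * t + t ^ 2 ≠ 0 := left_ne_zero_of_mul_eq_one hS
  refine ⟨hne, ?_⟩
  rw [← eq_inv_of_mul_eq_one_right hS]
  exact hs.hasSum

/-- The polynomials of the expansion `u = ∑ d_k P_k` of an analytic function, that is, `P_0 = 1` and
`P_k = 2 T_k` for `k ≥ 1`. -/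
noncomputable def chebP : ℕ → ℝ[X]
  | 0 => 1
  | k + 1 => 2 * Chebyshev.T ℝ (k + 1 : ℕ)

lemma chebP_add_two (k : ℕ) :
    chebP (k + 2) = Chebyshev.U ℝ (k + 2 : ℕ) - Chebyshev.U ℝ (k : ℕ) := by
  have := Chebyshev.two_mul_T_eq_U_sub_U (R := ℝ) k
  exact_mod_cast this

lemma abs_eval_chebP_le {x : ℝ} (hx : x ∈ Set.Icc (-1 : ℝ) 1) (k : ℕ) :
    |(chebP k).eval x| ≤ 2 := by
  cases k with
  | zero => simp [chebP]
  | succ k =>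
    have hT := Chebyshev.abs_eval_T_real_le_one (k + 1 : ℕ) (abs_le.mpr hx)
    rw [chebP, eval_mul, abs_mul, eval_ofNat, Nat.abs_ofNat]
    linarith

lemma hasSum_chebP {x : ℝ} (hx : x ∈ Set.Icc (-1 : ℝ) 1) {t : ℂ} (ht : ‖t‖ < 1) :
    HasSum (fun k : ℕ => (((chebP k).eval x : ℝ) : ℂ) * t ^ k)
      ((1 - t ^ 2) / (1 - 2 * x * t + t ^ 2)) := by
  have h := (hasSum_U hx ht).2
  have h1 := ((hasSum_nat_add_iff' 2).mpr h).sub (h.mul_left (t ^ 2))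
  rw [← hasSum_nat_add_iff' 2]
  convert h1 using 1
  · ext k
    rw [chebP_add_two, eval_sub]
    push_cast
    ring
  · simp [Finset.sum_range_succ, chebP]
    ring

lemma joukowski_sub_eq {w : ℂ} (hw : w ≠ 0) (x : ℂ) :
    joukowski w - x = w / 2 * (1 - 2 * x * w⁻¹ + w⁻¹ ^ 2) := by
  rw [joukowski]; field_simp; ring

lemma joukowski_sub_ne_zero {w : ℂ} (hw : 1 < ‖w‖) {x : ℝ} (hx : x ∈ Set.Icc (-1 : ℝ) 1) :
    joukowski w - x ≠ 0 := by
  have h0 : w ≠ 0 := by rintro rfl; simp at hw; linarith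
  have ht : ‖w⁻¹‖ < 1 := by rw [norm_inv]; exact inv_lt_one_of_one_lt₀ hw
  rw [joukowski_sub_eq h0]
  exact mul_ne_zero (by simpa using h0) (hasSum_U hx ht).1

lemma hasSum_inv_sub {w : ℂ} (hw : 1 < ‖w‖) {x : ℝ} (hx : x ∈ Set.Icc (-1 : ℝ) 1) :
    HasSum (fun k : ℕ => 2 / w ^ (k + 1) * (((Chebyshev.U ℝ k).eval x : ℝ) : ℂ))
      (1 / (joukowski w - x)) := by
  have h0 : w ≠ 0 := by rintro rfl; simp at hw; linarith
  have ht : ‖w⁻¹‖ < 1 := by rw [norm_inv]; exact inv_lt_one_of_one_lt₀ hw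
  have h := ((hasSum_U hx ht).2).mul_left (2 / w)
  rw [joukowski_sub_eq h0, one_div, mul_inv, inv_div]
  exact hasSum_of_eq h fun k => by rw [inv_pow, pow_succ]; field_simp

end Series

/-! ### The remainder as a functional on functions; the Laurent series and boundedness. -/

section Remainder

variable {n : ℕ} {α : ℝ}

lemma remainder_congr (hn : 1 ≤ n) (hα : -1 < α) {u v : ℂ → ℂ}
    (h : ∀ x ∈ Set.Icc (-1 : ℝ) 1, u x = v x) : remainder n α u = remainder n α v := by
  rw [remainder, remainder]
  congr 1
  · refine intervalIntegral.integral_congr fun x hx => ?_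
    rw [Set.uIcc_of_le (by norm_num)] at hx
    simp only [h x hx]
  · exact Finset.sum_congr rfl fun y hy => by
      rw [h y (Set.Ioo_subset_Icc_self (mem_Ioo_of_mem_nodes hn hα hy))]

lemma remainder_const_mul (c : ℂ) (u : ℂ → ℂ) :
    remainder n α (fun z => c * u z) = c * remainder n α u := by
  simp only [remainder, mul_assoc, intervalIntegral.integral_const_mul, ← Finset.mul_sum, mul_sub]

lemma intervalIntegrable_mul_weight_complex (hα : -1 < α) {u : ℝ → ℂ}
    (hu : ContinuousOn u (Set.Icc (-1) 1)) :
    IntervalIntegrable (fun x => u x * (weight α α x : ℂ)) volume (-1) 1 := by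
  have h : IntervalIntegrable (fun x => (weight α α x : ℂ)) volume (-1) 1 :=
    ⟨(intervalIntegrable_weight hα).1.ofReal, (intervalIntegrable_weight hα).2.ofReal⟩
  exact h.continuousOn_mul (by rwa [Set.uIcc_of_le (by norm_num)])

lemma remainder_add (hα : -1 < α) {u v : ℂ → ℂ}
    (hu : ContinuousOn (fun x : ℝ => u x) (Set.Icc (-1) 1))
    (hv : ContinuousOn (fun x : ℝ => v x) (Set.Icc (-1) 1)) :
    remainder n α (fun z => u z + v z) = remainder n α u + remainder n α v := by
  simp only [remainder, add_mul, Finset.sum_add_distrib]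
  rw [intervalIntegral.integral_add (intervalIntegrable_mul_weight_complex hα hu)
    (intervalIntegrable_mul_weight_complex hα hv)]
  ring

/-- The quadrature remainder of a series of real polynomials converging on `[-1, 1]`. -/
lemma hasSum_remainder (hn : 1 ≤ n) (hα : -1 < α) {u : ℂ → ℂ} {c : ℕ → ℂ} {P : ℕ → ℝ[X]}
    {b : ℕ → ℝ} (hb : ∀ k, ∀ x ∈ Set.Icc (-1 : ℝ) 1, |(P k).eval x| ≤ b k)
    (hs : Summable fun k => ‖c k‖ * b k)
    (h : ∀ x ∈ Set.Icc (-1 : ℝ) 1, HasSum (fun k => c k * (((P k).eval x : ℝ) : ℂ)) (u x)) :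
    HasSum (fun k => c k * (quadError n α hα (P k) : ℂ)) (remainder n α u) := by
  have hint : HasSum (fun k => ∫ x in (-1 : ℝ)..1,
      c k * (((P k).eval x : ℝ) : ℂ) * (weight α α x : ℂ))
      (∫ x in (-1 : ℝ)..1, u (x : ℂ) * (weight α α x : ℂ)) := by
    refine intervalIntegral.hasSum_integral_of_dominated_convergence
      (fun k x => ‖c k‖ * b k * |weight α α x|) ?_ ?_ ?_ ?_ ?_
    · intro k
      rw [Set.uIoc_of_le (by norm_num)]
      refine (intervalIntegrable_mul_weight_complex hα ?_).1.aestronglyMeasurable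
      fun_prop
    · intro k
      refine Filter.Eventually.of_forall fun x hx => ?_
      rw [Set.uIoc_of_le (by norm_num)] at hx
      rw [norm_mul, norm_mul, Complex.norm_real, Complex.norm_real, Real.norm_eq_abs,
        Real.norm_eq_abs]
      gcongr
      exact hb k x ⟨hx.1.le, hx.2⟩
    · exact Filter.Eventually.of_forall fun x _ => hs.mul_right _
    · simp only [tsum_mul_right]
      exact (intervalIntegrable_weight hα).abs.const_mul _
    · refine Filter.Eventually.of_forall fun x hx => ?_
      rw [Set.uIoc_of_le (by norm_num)] at hx
      exact (h x ⟨hx.1.le, hx.2⟩).mul_right _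
  have hsum : HasSum (fun k => ∑ y ∈ nodes n α,
      c k * (((P k).eval y : ℝ) : ℂ) * (gaussWeight n α y : ℂ))
      (∑ y ∈ nodes n α, u (y : ℂ) * (gaussWeight n α y : ℂ)) :=
    hasSum_sum fun y hy =>
      (h y (Set.Ioo_subset_Icc_self (mem_Ioo_of_mem_nodes hn hα hy))).mul_right _
  refine hasSum_of_eq (hint.sub hsum) fun k => ?_
  rw [quadError_apply, moment_apply, Complex.ofReal_sub, mul_sub, ← intervalIntegral.integral_ofReal,
    ← intervalIntegral.integral_const_mul, Complex.ofReal_sum, Finset.mul_sum]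
  congr 1
  · exact intervalIntegral.integral_congr fun x _ => by push_cast; ring
  · exact Finset.sum_congr rfl fun y _ => by push_cast; ring

lemma remainder_polynomial (hn : 1 ≤ n) (hα : -1 < α) {p : ℂ[X]} (hp : p.natDegree < 2 * n) :
    remainder n α (fun z => p.eval z) = 0 := by
  have h := hasSum_remainder hn hα (u := fun z => p.eval z) (c := p.coeff) (P := fun k => X ^ k)
    (b := fun _ => 1) ?_ ?_ ?_
  · refine h.unique ?_
    convert hasSum_zero with k
    rcases lt_or_ge k (2 * n) with hk | hk
    · rw [quadError_eq_zero hn hα (by rwa [natDegree_X_pow]), Complex.ofReal_zero, mul_zero]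
    · rw [coeff_eq_zero_of_natDegree_lt (hp.trans_le hk), zero_mul]
  · intro k x hx
    rw [eval_pow, eval_X, abs_pow]
    exact pow_le_one₀ (abs_nonneg x) (abs_le.mpr hx)
  · refine summable_of_ne_finset_zero (s := p.support) fun k hk => ?_
    rw [notMem_support_iff.mp hk, norm_zero, zero_mul]
  · intro x _
    rw [eval_eq_sum, Polynomial.sum]
    have h := hasSum_sum_of_ne_finset_zero (s := p.support) (L := SummationFilter.unconditional ℕ)
      (f := fun k => p.coeff k * (((X ^ k : ℝ[X]).eval x : ℝ) : ℂ)) fun k hk => by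
        rw [notMem_support_iff.mp hk, zero_mul]
    simpa using h

/-- J_n(z)/(z-x) is J_n(x)/(z-x) plus a divided difference, polynomial in x, on which the rule is
exact. The first summand vanishes at the nodes, so only its integral remains. -/
lemma remainder_inv_sub (hn : 1 ≤ n) (hα : -1 < α) {w : ℂ} (hw : 1 < ‖w‖) :
    J n α (joukowski w) * remainder n α (fun x => 1 / (joukowski w - x)) =
      2 * gam n α α * Q n α (joukowski w) := by
  set z := joukowski w with hz
  have hne : ∀ x ∈ Set.Icc (-1 : ℝ) 1, z - x ≠ 0 := fun x hx => joukowski_sub_ne_zero hw hx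
  obtain ⟨p, hp⟩ := X_sub_C_dvd_sub_C_eval (a := z) (p := (jacobi n α α).map (algebraMap ℝ ℂ))
  have hdeg : p.natDegree < 2 * n := by
    rcases eq_or_ne p 0 with rfl | h0
    · simp; omega
    have := congrArg natDegree hp
    rw [natDegree_sub_C, natDegree_map, natDegree_jacobi hn hα, natDegree_mul (X_sub_C_ne_zero z) h0,
      natDegree_X_sub_C] at this
    omega
  have hev : ∀ x : ℂ, J n α x - J n α z = (x - z) * p.eval x := by
    intro x
    have := congrArg (eval x) hp
    simpa [J, eval_map_algebraMap] using this
  have hreal : ∀ x : ℝ, J n α x = ((jacobi n α α).eval x : ℝ) := by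
    intro x
    rw [J, ← Complex.coe_algebraMap, aeval_algebraMap_apply]
    simp
  have hcont : ContinuousOn (fun x : ℝ => J n α x * (1 / (z - x))) (Set.Icc (-1) 1) := by
    refine ContinuousOn.mul ?_ (ContinuousOn.div (by fun_prop) (by fun_prop) hne)
    simp only [hreal]
    fun_prop
  rw [← remainder_const_mul, remainder_congr hn hα
    (v := fun x => J n α x * (1 / (z - x)) + p.eval x), remainder_add hα hcont (by fun_prop),
    remainder_polynomial hn hα hdeg, add_zero, remainder, Finset.sum_eq_zero, sub_zero, Q,
    ← mul_assoc, mul_one_div_cancel, one_mul]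
  · refine intervalIntegral.integral_congr fun x _ => ?_
    simp only [hreal]
    push_cast
    ring
  · have := (gam_pos hn hα).ne'
    exact mul_ne_zero two_ne_zero (by exact_mod_cast this)
  · intro y hy
    rw [hreal, eval_jacobi_of_mem_nodes hy]
    simp
  · intro x hx
    have h1 := hne x hx
    have h2 := hev x
    field_simp
    linear_combination -h2

lemma J_ne_zero (hn : 1 ≤ n) (hα : -1 < α) {w : ℂ} (hw : 1 < ‖w‖) :
    J n α (joukowski w) ≠ 0 := by
  intro h
  obtain ⟨x, hx, hxw⟩ := exists_of_aeval_jacobi_eq_zero hn hα h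
  exact joukowski_sub_ne_zero hw (Set.Ioo_subset_Icc_self hx) (sub_eq_zero.mpr hxw.symm)

lemma hasSum_Q_div_J (hn : 1 ≤ n) (hα : -1 < α) {w : ℂ} (hw : 1 < ‖w‖) :
    HasSum (fun l : ℕ => (mu n α l : ℂ) / w ^ (2 * n + 2 * l + 1))
      (Q n α (joukowski w) / J n α (joukowski w)) := by
  have h0 : w ≠ 0 := by rintro rfl; simp at hw; linarith
  have hJ := J_ne_zero hn hα hw
  have hg : (gam n α α : ℂ) ≠ 0 := by exact_mod_cast (gam_pos hn hα).ne'
  have h := hasSum_remainder hn hα (u := fun x => 1 / (joukowski w - x))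
    (c := fun k => 2 / w ^ (k + 1)) (P := fun k => Chebyshev.U ℝ k) (b := fun k => k + 1)
    (fun k x hx => abs_eval_U_le hx k) ?_ (fun x hx => hasSum_inv_sub hw hx)
  · have hinj : Function.Injective fun l : ℕ => 2 * n + 2 * l := fun a b hab => by
      simp only at hab; omega
    -- Only the indices 2n+2l carry a nonzero remainder.
    rw [← hinj.hasSum_iff] at h
    · have hr := remainder_inv_sub hn hα hw
      rw [show Q n α (joukowski w) / J n α (joukowski w) = 1 / (2 * (gam n α α : ℂ)) *
        remainder n α (fun x => 1 / (joukowski w - x)) by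
          rw [div_eq_iff hJ, mul_assoc, mul_comm _ (J n α _), hr]; field_simp]
      refine hasSum_of_eq (h.mul_left (1 / (2 * (gam n α α : ℂ)))) fun l => ?_
      rw [Function.comp_apply, quadError_U_even hn hα]
      push_cast
      field_simp
    · intro k hk
      rcases lt_or_ge k (2 * n) with hk' | hk'
      · rw [quadError_U_of_lt hn hα hk', Complex.ofReal_zero, mul_zero]
      · obtain ⟨j, rfl⟩ := Nat.exists_eq_add_of_le hk'
        rcases Nat.even_or_odd' j with ⟨l, rfl | rfl⟩
        · exact absurd ⟨l, rfl⟩ hk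
        · rw [quadError_U_odd hn hα, Complex.ofReal_zero, mul_zero]
  · have hr : ‖w‖⁻¹ < 1 := inv_lt_one_of_one_lt₀ hw
    refine ((summable_succ_mul_pow (by positivity) hr).mul_left (2 * ‖w‖⁻¹)).congr fun k => ?_
    rw [norm_div, norm_pow, pow_succ', inv_pow, Complex.norm_ofNat]
    field_simp

lemma quadError_chebP (hn : 1 ≤ n) (hα : -1 < α) (l : ℕ) :
    quadError n α hα (chebP (2 * n + 2 * (l + 1))) =
      gam n α α * (mu n α (l + 1) - mu n α l) := by
  rw [show 2 * n + 2 * (l + 1) = 2 * n + 2 * l + 2 by ring, chebP_add_two, map_sub,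
    show 2 * n + 2 * l + 2 = 2 * n + 2 * (l + 1) by ring, quadError_U_even hn hα,
    quadError_U_even hn hα, mul_sub]

lemma quadError_chebP_two_mul (hn : 1 ≤ n) (hα : -1 < α) :
    quadError n α hα (chebP (2 * n)) = gam n α α * mu n α 0 := by
  have h := quadError_U_even hn hα 0
  obtain ⟨m, hm⟩ := Nat.exists_eq_add_of_le (show 2 ≤ 2 * n by omega)
  rw [hm, add_comm, chebP_add_two, map_sub, quadError_U_of_lt hn hα (m := m) (by omega), sub_zero,
    ← h]
  congr 2
  omega

lemma quadError_chebP_eq_zero (hn : 1 ≤ n) (hα : -1 < α) {k : ℕ}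
    (hk : k ∉ Set.range fun l : ℕ => 2 * n + 2 * l) : quadError n α hα (chebP k) = 0 := by
  have key : ∀ j : ℕ, j ∉ (Set.range fun l : ℕ => 2 * n + 2 * l) →
      quadError n α hα (Chebyshev.U ℝ (j : ℤ)) = 0 := by
    intro j hj
    rcases lt_or_ge j (2 * n) with hj' | hj'
    · exact quadError_U_of_lt hn hα hj'
    · obtain ⟨j, rfl⟩ := Nat.exists_eq_add_of_le hj'
      rcases Nat.even_or_odd' j with ⟨l, rfl | rfl⟩
      · exact absurd ⟨l, rfl⟩ hj
      · exact quadError_U_odd hn hα l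
  -- The first two expansion polynomials are U_0 and U_1 themselves; from degree 2 on they are
  -- differences U_k - U_{k-2}.
  rcases k with _ | _ | k
  · have := key 0 (by rintro ⟨l, hl⟩; simp at hl; omega)
    simpa [chebP] using this
  · have := key 1 (by rintro ⟨l, hl⟩; simp at hl; omega)
    simpa [chebP] using this
  · rw [chebP_add_two, map_sub, key _ hk, key, sub_zero]
    rintro ⟨l, hl⟩
    exact hk ⟨l + 1, by simp only at hl ⊢; omega⟩

/-- The difference is E[2T_{2n+2l+2}]/γ_n, and E is bounded in the supremum norm on [-1,1]. -/
lemma bddAbove_mu_sub (hn : 1 ≤ n) (hα : -1 < α) :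
    BddAbove (Set.range fun l : ℕ => |mu n α (l + 1) - mu n α l|) := by
  have hg := gam_pos hn hα
  refine ⟨(2 * (∫ x in (-1 : ℝ)..1, |weight α α x|) + ∑ y ∈ nodes n α, |gaussWeight n α y| * 2) /
    gam n α α, ?_⟩
  rintro _ ⟨l, rfl⟩
  simp only
  rw [le_div_iff₀ hg, mul_comm, ← abs_of_pos hg, ← abs_mul,
    ← quadError_chebP hn hα l, quadError_apply, moment_apply]
  refine (abs_sub _ _).trans (add_le_add ?_ ?_)
  · rw [← intervalIntegral.integral_const_mul]
    rw [← Real.norm_eq_abs]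
    refine intervalIntegral.norm_integral_le_of_norm_le (by norm_num) ?_
      ((intervalIntegrable_weight hα).abs.const_mul _)
    refine Filter.Eventually.of_forall fun x hx => ?_
    rw [Real.norm_eq_abs, abs_mul]
    exact mul_le_mul_of_nonneg_right (abs_eval_chebP_le ⟨hx.1.le, hx.2⟩ _) (abs_nonneg _)
  · refine (Finset.abs_sum_le_sum_abs _ _).trans (Finset.sum_le_sum fun y hy => ?_)
    rw [abs_mul]
    exact mul_le_mul_of_nonneg_left (abs_eval_chebP_le
      (Set.Ioo_subset_Icc_self (mem_Ioo_of_mem_nodes hn hα hy)) _) (abs_nonneg _)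

end Remainder

/-! ### Chebyshev expansion of analytic functions on the ellipse, and the error bound. -/

section Cauchy

lemma joukowski_inv (w : ℂ) : joukowski w⁻¹ = joukowski w := by
  rw [joukowski, joukowski, inv_inv, add_comm]

/-- The Laurent coefficients of a function on the circle of radius `ρ`. -/
noncomputable def circleCoeff (ρ : ℝ) (v : ℂ → ℂ) (k : ℕ) : ℂ :=
  (2 * Real.pi * Complex.I : ℂ)⁻¹ • ∮ w in C(0, ρ), v w * (w ^ (k + 1))⁻¹

lemma norm_circleCoeff_le {ρ : ℝ} (hρ : 0 < ρ) {v : ℂ → ℂ} {M : ℝ}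
    (hM : ∀ w ∈ Metric.sphere (0 : ℂ) ρ, ‖v w‖ ≤ M) (k : ℕ) :
    ‖circleCoeff ρ v k‖ ≤ M / ρ ^ k := by
  have h := circleIntegral.norm_two_pi_i_inv_smul_integral_le_of_norm_le_const (c := 0)
    (f := fun w => v w * (w ^ (k + 1))⁻¹) (C := M / ρ ^ (k + 1)) hρ.le fun w hw => by
      have hw' : ‖w‖ = ρ := by simpa using hw
      rw [norm_mul, norm_inv, norm_pow, hw', div_eq_mul_inv]
      exact mul_le_mul_of_nonneg_right (hM w hw) (by positivity)
  refine h.trans_eq ?_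
  rw [pow_succ]
  field_simp

lemma circleCoeff_one {ρ : ℝ} (hρ : 0 < ρ) (k : ℕ) :
    circleCoeff ρ (fun _ => 1) k = if k = 0 then 1 else 0 := by
  have h2 : (2 * Real.pi * Complex.I : ℂ) ≠ 0 := Complex.two_pi_I_ne_zero
  rw [circleCoeff]
  simp only [one_mul]
  split_ifs with hk
  · subst hk
    have := circleIntegral.integral_sub_center_inv 0 hρ.ne'
    simp only [sub_zero] at this
    simp only [zero_add, pow_one, this, smul_eq_mul]
    exact inv_mul_cancel₀ h2
  · have := circleIntegral.integral_sub_zpow_of_ne (n := -((k + 1 : ℕ) : ℤ)) (by omega) 0 0 ρ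
    simp only [sub_zero, zpow_neg, zpow_natCast] at this
    rw [this, smul_zero]

/-- The Cauchy kernel of the Bernstein ellipse, pulled back to the circle. -/
noncomputable def cauchyKernel (x : ℝ) (w : ℂ) : ℂ :=
  (1 - w⁻¹ ^ 2) / (2 * (joukowski w - x))

lemma cauchyKernel_eq {w : ℂ} (hw : w ≠ 0) (x : ℝ) :
    cauchyKernel x w = w⁻¹ * ((1 - w⁻¹ ^ 2) / (1 - 2 * x * w⁻¹ + w⁻¹ ^ 2)) := by
  rw [cauchyKernel, joukowski_sub_eq hw, show 2 * (w / 2 * (1 - 2 * x * w⁻¹ + w⁻¹ ^ 2)) =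
    w * (1 - 2 * x * w⁻¹ + w⁻¹ ^ 2) by ring, ← div_div, div_right_comm, div_eq_inv_mul _ w]

/-- The kernel is Σ P_k(x) w^{-k-1}, integrated termwise. Mere continuity of v on the circle
suffices; analyticity enters only in identifying the sum. -/
lemma hasSum_circleCoeff {ρ : ℝ} (hρ : 1 < ρ) {v : ℂ → ℂ}
    (hv : ContinuousOn v (Metric.sphere (0 : ℂ) ρ)) {x : ℝ} (hx : x ∈ Set.Icc (-1 : ℝ) 1) :
    HasSum (fun k => circleCoeff ρ v k * (((chebP k).eval x : ℝ) : ℂ))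
      ((2 * Real.pi * Complex.I : ℂ)⁻¹ • ∮ w in C(0, ρ), v w * cauchyKernel x w) := by
  have h0 : 0 < ρ := by linarith
  have hne : ∀ θ : ℝ, circleMap 0 ρ θ ≠ 0 := fun θ => circleMap_ne_center h0.ne'
  obtain ⟨B, hB⟩ := (isCompact_sphere (0 : ℂ) ρ).exists_bound_of_continuousOn hv
  have hB0 : 0 ≤ B := (norm_nonneg _).trans (hB _ (circleMap_mem_sphere 0 h0.le 0))
  have hvc : Continuous fun θ => v (circleMap 0 ρ θ) :=
    hv.comp_continuous (continuous_circleMap 0 ρ) fun θ => circleMap_mem_sphere 0 h0.le θ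
  have key : HasSum (fun k : ℕ => ∮ w in C(0, ρ),
      v w * (w ^ (k + 1))⁻¹ * (((chebP k).eval x : ℝ) : ℂ))
      (∮ w in C(0, ρ), v w * cauchyKernel x w) := by
    refine intervalIntegral.hasSum_integral_of_dominated_convergence
      (fun k _ => 2 * B * ρ⁻¹ ^ k) ?_ ?_ ?_ ?_ ?_
    · intro k
      refine Continuous.aestronglyMeasurable ?_
      simp only [deriv_circleMap, smul_eq_mul]
      refine ((continuous_circleMap 0 ρ).mul continuous_const).mul
        ((hvc.mul (Continuous.inv₀ ?_ fun θ => pow_ne_zero _ (hne θ))).mul continuous_const)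
      exact (continuous_circleMap 0 ρ).pow _
    · refine fun k => Filter.Eventually.of_forall fun θ _ => ?_
      have h1 := hB _ (circleMap_mem_sphere 0 h0.le θ)
      have h2 := abs_eval_chebP_le hx k
      simp only [deriv_circleMap, smul_eq_mul, norm_mul, norm_inv, norm_pow, norm_circleMap_zero,
        Complex.norm_I, mul_one, Complex.norm_real, Real.norm_eq_abs, abs_of_pos h0]
      calc ρ * (‖v (circleMap 0 ρ θ)‖ * (ρ ^ (k + 1))⁻¹ * |(chebP k).eval x|)
          ≤ ρ * (B * (ρ ^ (k + 1))⁻¹ * 2) := by gcongr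
        _ = 2 * B * ρ⁻¹ ^ k := by rw [pow_succ, inv_pow]; field_simp
    · refine Filter.Eventually.of_forall fun θ _ => ?_
      exact (summable_geometric_of_lt_one (by positivity) (inv_lt_one_of_one_lt₀ hρ)).mul_left _
    · exact intervalIntegrable_const
    · refine Filter.Eventually.of_forall fun θ _ => HasSum.const_smul _ ?_
      have ht : ‖(circleMap 0 ρ θ)⁻¹‖ < 1 := by
        rw [norm_inv, norm_circleMap_zero, abs_of_pos h0]; exact inv_lt_one_of_one_lt₀ hρ
      simp only [cauchyKernel_eq (hne θ)]
      refine hasSum_of_eq (((hasSum_chebP hx ht).mul_left (circleMap 0 ρ θ)⁻¹).mul_left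
        (v (circleMap 0 ρ θ))) fun k => ?_
      rw [pow_succ, inv_pow, mul_inv]
      ring
  refine hasSum_of_eq (key.const_smul (2 * Real.pi * Complex.I : ℂ)⁻¹) fun k => ?_
  rw [circleCoeff, smul_mul_assoc]
  congr 1
  have := circleIntegral.integral_smul_const (fun w : ℂ => v w * (w ^ (k + 1))⁻¹)
    (((chebP k).eval x : ℝ) : ℂ) 0 ρ
  simpa only [smul_eq_mul] using this.symm

/-- Read off from the expansion of the constant 1, whose only nonzero coefficient is the one at k =
0; no residue at x is computed. -/
lemma circleIntegral_cauchyKernel {ρ : ℝ} (hρ : 1 < ρ) {x : ℝ} (hx : x ∈ Set.Icc (-1 : ℝ) 1) :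
    (2 * Real.pi * Complex.I : ℂ)⁻¹ • ∮ w in C(0, ρ), cauchyKernel x w = 1 := by
  have h := hasSum_circleCoeff hρ (v := fun _ => 1) continuousOn_const hx
  simp only [one_mul, circleCoeff_one (zero_lt_one.trans hρ)] at h
  refine h.unique ?_
  have h1 := hasSum_ite_eq (0 : ℕ) (1 : ℂ)
  refine hasSum_of_eq h1 fun k => ?_
  rcases k with _ | k <;> simp [chebP]

/-- The unit circle covers [-1,1] twice in opposite directions: under w ↦ 1/w the Joukowski map is
invariant while (1-w^{-2})dw changes sign. No regularity of q is needed. -/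
lemma circleIntegral_symm_eq_zero (q : ℂ → ℂ) :
    (∮ w in C(0, 1), q (joukowski w) * ((1 - w⁻¹ ^ 2) / 2)) = 0 := by
  have hinv : ∀ θ : ℝ, circleMap 0 1 (2 * Real.pi - θ) = (circleMap 0 1 θ)⁻¹ := by
    intro θ
    simp only [circleMap_zero, Complex.ofReal_one, one_mul, ← Complex.exp_neg]
    push_cast
    rw [sub_mul, sub_eq_neg_add, Complex.exp_add, Complex.exp_two_pi_mul_I, mul_one]
  have hne : ∀ θ : ℝ, circleMap 0 1 θ ≠ 0 := fun θ => circleMap_ne_center one_ne_zero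
  rw [circleIntegral]
  set Φ : ℝ → ℂ := fun θ => deriv (circleMap 0 1) θ •
    (q (joukowski (circleMap 0 1 θ)) * ((1 - (circleMap 0 1 θ)⁻¹ ^ 2) / 2)) with hΦ
  have hodd : ∀ θ, Φ (2 * Real.pi - θ) = -Φ θ := by
    intro θ
    have := hne θ
    simp only [hΦ, deriv_circleMap, hinv, joukowski_inv, smul_eq_mul, inv_inv]
    field_simp
    ring
  have h := intervalIntegral.integral_comp_sub_left (a := 0) (b := 2 * Real.pi) Φ (2 * Real.pi)
  rw [sub_self, sub_zero, intervalIntegral.integral_congr fun θ _ => hodd θ,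
    intervalIntegral.integral_neg] at h
  exact neg_eq_self.mp h

variable {ρ : ℝ} {u : ℂ → ℂ}

lemma ofReal_mem_ellipseRegion (hρ : 1 < ρ) {x : ℝ} (hx : x ∈ Set.Icc (-1 : ℝ) 1) :
    (x : ℂ) ∈ ellipseRegion ρ := by
  refine ⟨Complex.exp (Real.arccos x * Complex.I), ?_, ?_⟩
  · rw [Set.mem_ofPred_eq, Complex.norm_exp_ofReal_mul_I]
    exact ⟨le_rfl, hρ.le⟩
  · rw [joukowski, ← Complex.exp_neg, ← neg_mul]
    rw [← Complex.cos, ← Complex.ofReal_cos, Real.cos_arccos hx.1 hx.2]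

lemma continuousOn_comp_joukowski (hρ : 1 < ρ) (hu : AnalyticOnWithin ρ u) :
    ContinuousOn (fun w => u (joukowski w)) (Metric.sphere (0 : ℂ) ρ) := by
  intro w hw
  have hw' : ‖w‖ = ρ := by simpa using hw
  have h0 : w ≠ 0 := by rintro rfl; simp at hw'; linarith
  have h1 : ContinuousAt u (joukowski w) :=
    (hu _ ⟨w, ⟨by linarith, hw'.le⟩, rfl⟩).continuousAt
  have h2 : ContinuousAt joukowski w := by
    unfold joukowski
    exact (continuousAt_id.add (continuousAt_inv₀ h0)).div_const _
  exact (ContinuousAt.comp (f := joukowski) (x := w) h1 h2).continuousWithinAt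

/-- The difference quotient of u is holomorphic at x too, so the contour shrinks through the annulus
1 ≤ |w| ≤ ρ to the unit circle, where symmetry gives zero. -/
lemma circleIntegral_dslope_eq_zero (hρ : 1 < ρ) (hu : AnalyticOnWithin ρ u) {x : ℝ}
    (hx : x ∈ Set.Icc (-1 : ℝ) 1) :
    (∮ w in C(0, ρ), dslope u x (joukowski w) * ((1 - w⁻¹ ^ 2) / 2)) = 0 := by
  have hV : IsOpen {z | AnalyticAt ℂ u z} := isOpen_analyticAt ℂ u
  have hd : DifferentiableOn ℂ (dslope u x) {z | AnalyticAt ℂ u z} :=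
    (Complex.differentiableOn_dslope (hV.mem_nhds (hu _ (ofReal_mem_ellipseRegion hρ hx)))).mpr
      fun z hz => hz.differentiableAt.differentiableWithinAt
  have hD : ∀ w : ℂ, 1 ≤ ‖w‖ → ‖w‖ ≤ ρ → DifferentiableAt ℂ
      (fun w => dslope u x (joukowski w) * ((1 - w⁻¹ ^ 2) / 2)) w := by
    intro w h1 h2
    have h0 : w ≠ 0 := by rintro rfl; simp at h1; linarith
    have hq : DifferentiableAt ℂ (dslope u x) (joukowski w) :=
      hd.differentiableAt (hV.mem_nhds (hu _ ⟨w, ⟨h1, h2⟩, rfl⟩))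
    have hi : DifferentiableAt ℂ (fun w : ℂ => w⁻¹) w := differentiableAt_inv h0
    have hj : DifferentiableAt ℂ joukowski w := by
      unfold joukowski
      exact (differentiableAt_id.add hi).div_const _
    exact (DifferentiableAt.comp w hq hj).mul (((hi.pow 2).const_sub 1).div_const 2)
  rw [Complex.circleIntegral_eq_of_differentiable_on_annulus_off_countable zero_lt_one hρ.le
    Set.countable_empty, circleIntegral_symm_eq_zero]
  · rintro w ⟨hw1, hw2⟩
    refine (hD w ?_ ?_).continuousAt.continuousWithinAt
    · simpa using hw2
    · simpa using hw1
  · rintro w ⟨⟨hw1, hw2⟩, -⟩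
    refine hD w ?_ ?_
    · have : 1 < ‖w‖ := by simpa using hw2
      exact this.le
    · have : ‖w‖ < ρ := by simpa using hw1
      exact this.le

/-- Cauchy's formula on the ellipse, by writing u(z) = u(x) + (z-x)·(difference quotient): the
second part integrates to zero and the kernel has total mass 1. -/
lemma hasSum_chebyshev (hρ : 1 < ρ) (hu : AnalyticOnWithin ρ u) {x : ℝ}
    (hx : x ∈ Set.Icc (-1 : ℝ) 1) :
    HasSum (fun k => circleCoeff ρ (fun w => u (joukowski w)) k * (((chebP k).eval x : ℝ) : ℂ))
      (u x) := by
  have h0 : 0 < ρ := by linarith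
  have hc := continuousOn_comp_joukowski hρ hu
  have h := hasSum_circleCoeff hρ hc hx
  have hK : ContinuousOn (cauchyKernel x) (Metric.sphere (0 : ℂ) ρ) := by
    have hne : ∀ w ∈ Metric.sphere (0 : ℂ) ρ, w ≠ 0 := fun w hw =>
      ne_zero_of_mem_sphere h0.ne' ⟨w, hw⟩
    have hi : ContinuousOn (fun w : ℂ => w⁻¹) (Metric.sphere (0 : ℂ) ρ) :=
      continuousOn_id.inv₀ hne
    refine ContinuousOn.div (continuousOn_const.sub (hi.pow 2)) (continuousOn_const.mul
      (((continuousOn_id.add hi).div_const 2).sub continuousOn_const)) fun w hw => ?_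
    have hw' : ‖w‖ = ρ := by simpa using hw
    exact mul_ne_zero two_ne_zero (joukowski_sub_ne_zero (by linarith) hx)
  have e : (∮ w in C(0, ρ), u (joukowski w) * cauchyKernel x w) =
      (∮ w in C(0, ρ), dslope u x (joukowski w) * ((1 - w⁻¹ ^ 2) / 2)) +
        u x * ∮ w in C(0, ρ), cauchyKernel x w := by
    have hi1 : CircleIntegrable (fun w => u (joukowski w) * cauchyKernel x w) 0 ρ :=
      (hc.mul hK).circleIntegrable h0.le
    have hi2 : CircleIntegrable (fun w => u x * cauchyKernel x w) 0 ρ :=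
      (continuousOn_const.mul hK).circleIntegrable h0.le
    rw [← sub_eq_iff_eq_add, ← circleIntegral.integral_const_mul,
      ← circleIntegral.integral_sub hi1 hi2]
    refine circleIntegral.integral_congr h0.le fun w hw => ?_
    have hw' : ‖w‖ = ρ := by simpa using hw
    have hne := joukowski_sub_ne_zero (w := w) (by linarith) hx
    simp only [dslope_of_ne _ (sub_ne_zero.mp hne), slope_def_field, cauchyKernel]
    field_simp
  rw [e, circleIntegral_dslope_eq_zero hρ hu hx, zero_add, ← smul_eq_mul (u x), smul_comm,
    circleIntegral_cauchyKernel hρ hx, smul_eq_mul, mul_one] at h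
  exact h

lemma norm_le_maxOnEllipse (hρ : 1 < ρ) (hu : AnalyticOnWithin ρ u) {w : ℂ}
    (hw : w ∈ Metric.sphere (0 : ℂ) ρ) : ‖u (joukowski w)‖ ≤ maxOnEllipse ρ u := by
  obtain ⟨B, hB⟩ := (isCompact_sphere (0 : ℂ) ρ).exists_bound_of_continuousOn
    (continuousOn_comp_joukowski hρ hu)
  refine le_csSup ⟨B, ?_⟩ ⟨_, ⟨w, by simpa using hw, rfl⟩, rfl⟩
  rintro _ ⟨_, ⟨v, hv, rfl⟩, rfl⟩
  exact hB v (by simpa using hv)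

lemma norm_remainder_le {n : ℕ} {α : ℝ} (hn : 1 ≤ n) (hα : -1 < α) (hρ : 1 < ρ)
    (hu : AnalyticOnWithin ρ u) :
    ‖remainder n α u‖ ≤ gam n α α * (|mu n α 0| +
      (⨆ l : ℕ, |mu n α (l + 1) - mu n α l|) * (1 / (ρ ^ 2 - 1))) *
        (maxOnEllipse ρ u / ρ ^ (2 * n)) := by
  have h0 : 0 < ρ := by linarith
  have hg := gam_pos hn hα
  set M := maxOnEllipse ρ u with hM
  set S := ⨆ l : ℕ, |mu n α (l + 1) - mu n α l| with hS
  set d := circleCoeff ρ (fun w => u (joukowski w)) with hd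
  have hdM : ∀ k, ‖d k‖ ≤ M / ρ ^ k :=
    norm_circleCoeff_le h0 fun w hw => norm_le_maxOnEllipse hρ hu hw
  have hr : ρ⁻¹ < 1 := inv_lt_one_of_one_lt₀ hρ
  have h := hasSum_remainder hn hα (u := u) (c := d) (P := chebP) (b := fun _ => 2)
    (fun k x hx => abs_eval_chebP_le hx k) ?_ (fun x hx => hasSum_chebyshev hρ hu hx)
  · have hinj : Function.Injective fun l : ℕ => 2 * n + 2 * l := fun a b hab => by
      simp only at hab; omega
    rw [← hinj.hasSum_iff fun k hk => by
      rw [quadError_chebP_eq_zero hn hα hk, Complex.ofReal_zero, mul_zero]] at h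
    have hM0 : 0 ≤ M := by simpa using (norm_nonneg _).trans (hdM 0)
    have hq : ρ⁻¹ ^ 2 < 1 := pow_lt_one₀ (by positivity) hr two_ne_zero
    have hgeo := ((hasSum_geometric_of_lt_one (by positivity) hq).mul_left
      (gam n α α * S * (M / ρ ^ (2 * n)) * ρ⁻¹ ^ 2))
    -- The l = 0 term of the majorant carries |μ_{n,0}|, since U_{2n-2} is integrated exactly; the
    -- later terms form the geometric series with the supremum as factor.
    have hbound : HasSum (fun l : ℕ => Nat.casesOn (motive := fun _ => ℝ) l
        (gam n α α * |mu n α 0| * (M / ρ ^ (2 * n)))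
        fun l => gam n α α * S * (M / ρ ^ (2 * n)) * ρ⁻¹ ^ 2 * (ρ⁻¹ ^ 2) ^ l)
        (gam n α α * S * (M / ρ ^ (2 * n)) * ρ⁻¹ ^ 2 * (1 - ρ⁻¹ ^ 2)⁻¹ +
          gam n α α * |mu n α 0| * (M / ρ ^ (2 * n))) := by
      rw [← hasSum_nat_add_iff' 1]
      simpa using hgeo
    refine (h.norm_le_of_bounded hbound fun l => ?_).trans_eq ?_
    · rcases l with _ | l
      · simp only [Function.comp_apply, mul_zero, add_zero, quadError_chebP_two_mul hn hα, norm_mul,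
          Complex.norm_real, Real.norm_eq_abs, abs_of_pos hg]
        rw [mul_comm]
        exact mul_le_mul_of_nonneg_left (hdM _) (by positivity)
      · simp only [Function.comp_apply, quadError_chebP hn hα, norm_mul,
          Complex.norm_real, Real.norm_eq_abs, abs_of_pos hg]
        have h1 : |mu n α (l + 1) - mu n α l| ≤ S := le_ciSup (bddAbove_mu_sub hn hα) l
        have h2 := hdM (2 * n + 2 * (l + 1))
        have hMd : 0 ≤ M / ρ ^ (2 * n + 2 * (l + 1)) := by positivity
        calc ‖d (2 * n + 2 * (l + 1))‖ * (gam n α α * |mu n α (l + 1) - mu n α l|)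
            ≤ M / ρ ^ (2 * n + 2 * (l + 1)) * (gam n α α * S) := by gcongr
          _ = _ := by
            rw [pow_add, pow_mul ρ 2 (l + 1), pow_succ (ρ ^ 2) l, inv_pow, inv_pow]
            field_simp
    · have h3 : ρ ^ 2 - 1 ≠ 0 := by nlinarith
      have h4 : (1 : ℝ) - ρ⁻¹ ^ 2 ≠ 0 := by linarith
      have h5 : ρ⁻¹ ^ 2 * (1 - ρ⁻¹ ^ 2)⁻¹ = 1 / (ρ ^ 2 - 1) := by
        rw [← div_eq_mul_inv, div_eq_div_iff h4 h3]
        field_simp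
      rw [mul_assoc _ (ρ⁻¹ ^ 2), h5]
      ring
  · refine Summable.of_nonneg_of_le (fun k => by positivity) (fun k => ?_)
      ((summable_geometric_of_lt_one (by positivity) hr).mul_left (2 * M))
    have := hdM k
    rw [inv_pow]
    calc ‖d k‖ * 2 ≤ M / ρ ^ k * 2 := by gcongr
      _ = _ := by ring

end Cauchy

end GegenbauerGauss

theorem mainTheorem3 (n : ℕ) (hn : 1 ≤ n) (α : ℝ) (hα : -1 < α) :
    (∀ w : ℂ, 1 < ‖w‖ →
      GegenbauerGauss.J n α (GegenbauerGauss.joukowski w) ≠ 0 ∧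
      HasSum (fun l : ℕ => (GegenbauerGauss.mu n α l : ℂ) / w ^ (2 * n + 2 * l + 1))
        (GegenbauerGauss.Q n α (GegenbauerGauss.joukowski w) /
          GegenbauerGauss.J n α (GegenbauerGauss.joukowski w))) ∧
    BddAbove (Set.range fun l : ℕ =>
      |GegenbauerGauss.mu n α (l + 1) - GegenbauerGauss.mu n α l|) ∧
    ∀ (ρ : ℝ), 1 < ρ → ∀ u : ℂ → ℂ, GegenbauerGauss.AnalyticOnWithin ρ u →
      ‖GegenbauerGauss.remainder n α u‖ ≤
        GegenbauerGauss.gam n α α *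
          (|GegenbauerGauss.mu n α 0| +
            (⨆ l : ℕ, |GegenbauerGauss.mu n α (l + 1) - GegenbauerGauss.mu n α l|) *
              (1 / (ρ ^ 2 - 1))) *
          (GegenbauerGauss.maxOnEllipse ρ u / ρ ^ (2 * n)) := by
  exact ⟨fun w hw => ⟨GegenbauerGauss.J_ne_zero hn hα hw, GegenbauerGauss.hasSum_Q_div_J hn hα hw⟩,
    GegenbauerGauss.bddAbove_mu_sub hn hα,
    fun ρ hρ u hu => GegenbauerGauss.norm_remainder_le hn hα hρ hu⟩
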